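/- Let $N\ge 5$, let $d$ be an even positive integer with $d\le N-2$, and let $K,n$ be non-negative integers. For a permutation $\pi=(\pi_1,\dots,\pi_N)$ of $\{1,\dots,N\}$, with indices read cyclically ($\pi_{N+j}:=\pi_j$), let $E=E(\pi)$ be the symmetric set of all pairs $(\pi_i,\pi_{i+j})$ and $(\pi_{i+j},\pi_i)$ with $1\le i\le N$, $1\le j\le d/2$; let $H\in\{0,1\}^{N\times N}$ be its matrix ($H_{ab}=1$ iff $(a,b)\in E$), and let $S:=E\cup\{(a,a):1\le a\le N\}$. Call a probability law on $\mathbb{R}^N$ multivariate sub-Gaussian with precision matrix $\Omega\succ0$ and parameter $\sigma$ if it has mean $0$ and covariance $\Sigma=\Omega^{-1}$, and if each $X_i/\sqrt{\Sigma_{ii}}$ satisfies $\mathbb{E}\,e^{\lambda X_i/\sqrt{\Sigma_{ii}}}\le e^{\sigma^2\lambda^2/2}$ for all $\lambda\in\mathbb{R}$. **Experiment.** Let $\pi$ be a uniformly random permutation. Let $Q^{(1)},\dots,Q^{(K)}$ be (random or deterministic) matrices, jointly independent of $\pi$, that are almost surely symmetric with entries in $[-1/(2d),1/(2d)]$. Conditionally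 on $\pi$ and $\mathbf Q=(Q^{(k)})_k$, let $\mathbf X=\{X^{(k)}_t\}_{1\le t\le n,\,1\le k\le K}$ be independent with $X^{(k)}_t\sim\mathcal N(0,\bar\Sigma^{(k)})$, where $\bar\Sigma^{(k)}=(I+H\odot Q^{(k)})^{-1}$ and $\odot$ is the entrywise product. 1. For every $\pi$, each $a$ has exactly $d$ neighbours in $E$. For every symmetric $Q$ with entries in $[-1/(2d),1/(2d)]$, the matrix $I+H\odot Q$ is positive definite, its support is contained in $S$, and $\mathcal N(0,(I+H\odot Q)^{-1})$ is multivariate sub-Gaussian with precision matrix $I+H\odot Q$ and every parameter $\sigma\ge1$. Moreover, let $Q_0$ be symmetric with entries in $[-1/(2d),1/(2d)]$ and non-zero off-diagonal entries, and fix a value of $\pi$. Put $\bar\Omega=I+H\odot Q_0$ and $\Delta^{(k)}=H\odot(Q^{(k)}-Q_0)$. If the $Q^{(k)}$ are i.i.d. and, for some $0<c\le\lambda_{\min}(\bar\Omega)/2$, almost surely $\|\Delta^{(k)}\|_2\le c$ (spectral norm) for all $k$, then $\operatorname{supp}\bar\Omega=S$ and, conditionally on $\pi$, for every $\sigma\ge1$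 the samples $\mathbf X$ follow a family of random multivariate sub-Gaussian distributions of size $K$ with parameter $\sigma$ and true common precision matrix $\bar\Omega$. That is: $\bar\Omega\succ0$; the $\Delta^{(k)}$ are i.i.d.; there are $\gamma>0$ and $c_{\max}\in(0,\lambda_{\min}(\bar\Omega)/2]$ such that almost surely, for all $k$, $\bar\Omega+\Delta^{(k)}\succ0$, $\operatorname{supp}\Delta^{(k)}\subseteq\operatorname{supp}\bar\Omega$, all entries of $(\bar\Omega+\Delta^{(k)})^{-1}$ are at most $\gamma$ in absolute value and $\|\Delta^{(k)}\|_2\le c_{\max}$; the entries of $(\bar\Omega+\Delta^{(k)})^{-1}$ are integrable; and, given the $\bar\Omega+\Delta^{(k)}$, the samples are independent, those of task $k$ being identically distributed and multivariate sub-Gaussian with precision matrix $\bar\Omega+\Delta^{(k)}$ and parameter $\sigma$. 2. In every such experiment, for every estimate $\hat S$ of $S$ (a measurable function of $\mathbf X$, possibly also of $\mathbf Q$ and of external randomness independent of $(\pi,\mathbf Q,\mathbf X)$), $$\mathbb{P}\{\hat S\neq S\}\ \ge\ 1-\frac{nNK+\log 2}{N\log N-N-\log(2N)} .$$ 3. If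 moreover $K\ge1$ and $n\le\frac{\log N}{2K}-\frac1{2K}-\frac{\log(8N)}{2NK}$, then $\mathbb{P}\{\hat S\ne S\}>1/2$ for every such $\hat S$. Hence $\Omega((\log N)/K)$ samples per task are necessary: there are absolute constants $c>0$ and $N_0$ such that, for all $N\ge\max(N_0,5)$, all even $d$ with $0<d\le N-2$, all $K\ge1$ and all $n$, in every such experiment any estimate $\hat S$ with $\mathbb{P}\{\hat S\neq S\}\le1/2$ requires $n\ge c\,(\log N)/K$. -/

import Mathlib

open MeasureTheory ProbabilityTheory
open scoped Matrix ENNReal NNReal Nat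

noncomputable section

namespace SupportUnion

/-- Real `N × N` arrays, with the product σ-algebra. -/
abbrev Coupling (N : ℕ) := Fin N → Fin N → ℝ

/-- `n` observations in `ℝ^N` for each of `K` tasks. -/
abbrev Data (N K n : ℕ) := Fin K → Fin n → EuclideanSpace ℝ (Fin N)

/-- Permutations of a finite set carry the discrete σ-algebra. -/
instance permMeasurableSpace (N : ℕ) : MeasurableSpace (Equiv.Perm (Fin N)) := ⊤

/-- The support of a matrix. -/
def matSupport {N : ℕ} (A : Matrix (Fin N) (Fin N) ℝ) : Set (Fin N × Fin N) :=
  {p | A p.1 p.2 ≠ 0}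

/-- The position `j` steps after `i` on the cycle `0, 1, …, N - 1, 0, …`. -/
def cyclicShift {N : ℕ} (i : Fin N) (j : ℕ) : Fin N :=
  ⟨(i.val + j) % N, Nat.mod_lt _ i.pos⟩

/-- The edge set produced by the permutation `π`: the pairs `(π i, π (i + j))`, `1 ≤ j ≤ d / 2`,
indices taken cyclically. The graph is undirected, so both orientations are recorded. -/
def edgeSet {N : ℕ} (d : ℕ) (π : Equiv.Perm (Fin N)) : Set (Fin N × Fin N) :=
  {p | ∃ i : Fin N, ∃ j : ℕ, 1 ≤ j ∧ j ≤ d / 2 ∧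
    (p = (π i, π (cyclicShift i j)) ∨ p = (π (cyclicShift i j), π i))}

/-- The support union: the edges together with the diagonal. -/
def supportUnion {N : ℕ} (d : ℕ) (π : Equiv.Perm (Fin N)) : Set (Fin N × Fin N) :=
  edgeSet d π ∪ {p | p.1 = p.2}

/-- The `0`-`1` matrix `H` of the edge set. -/
def edgeMatrix {N : ℕ} (d : ℕ) (π : Equiv.Perm (Fin N)) : Matrix (Fin N) (Fin N) ℝ :=
  Matrix.of fun a b => (edgeSet d π).indicator (fun _ => (1 : ℝ)) (a, b)

/-- The precision matrix `I + H ⊙ Q`. -/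
def precision {N : ℕ} (d : ℕ) (π : Equiv.Perm (Fin N)) (q : Coupling N) :
    Matrix (Fin N) (Fin N) ℝ :=
  1 + edgeMatrix d π ⊙ Matrix.of q

/-- Symmetric matrices with entries in `[-1/(2d), 1/(2d)]`. -/
def couplingBox (N d : ℕ) : Set (Coupling N) :=
  {q | (∀ a b, q a b = q b a) ∧
    ∀ a b, q a b ∈ Set.Icc (-(1 / (2 * (d : ℝ)))) (1 / (2 * (d : ℝ)))}

/-- The law `μ` on `ℝ^N` is a multivariate sub-Gaussian distribution with precision matrix `A`
and parameter `σ`: it is centred with covariance `A⁻¹`, and each coordinate divided by its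
standard deviation is sub-Gaussian with parameter `σ`. -/
structure IsSubGaussianVector {N : ℕ} (μ : Measure (EuclideanSpace ℝ (Fin N)))
    (A : Matrix (Fin N) (Fin N) ℝ) (σ : ℝ≥0) : Prop where
  isProbabilityMeasure : IsProbabilityMeasure μ
  posDef : A.PosDef
  memLp : ∀ i, MemLp (fun x : EuclideanSpace ℝ (Fin N) => x i) 2 μ
  mean : ∀ i, ∫ x, x i ∂μ = 0
  covariance : ∀ i j, cov[fun x : EuclideanSpace ℝ (Fin N) => x i, fun x => x j; μ] = A⁻¹ i j
  subGaussian : ∀ i, HasSubgaussianMGF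
    (fun x : EuclideanSpace ℝ (Fin N) => x i / Real.sqrt (A⁻¹ i i)) (σ ^ 2) μ

/-- The samples `X` follow a family of random `N`-dimensional multivariate sub-Gaussian
distributions of size `K` with parameter `σ`, true common precision matrix `A` and random
deviations `Δ`. Given the precision matrices `A + Δ^(k)`, the samples are independent, and those of
task `k` have the common law `law k (A + Δ^(k))`. -/
structure IsRandomSubGaussianFamily {Ω : Type*} [MeasurableSpace Ω] {N K n : ℕ} (P : Measure Ω)
    (A : Matrix (Fin N) (Fin N) ℝ) (Δ : Ω → Fin K → Coupling N) (X : Ω → Data N K n)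
    (σ : ℝ≥0) : Prop where
  posDef : A.PosDef
  measurable_dev : Measurable Δ
  measurable_data : Measurable X
  indep : iIndepFun (fun k ω => Δ ω k) P
  identDistrib : ∀ k l, IdentDistrib (fun ω => Δ ω k) (fun ω => Δ ω l) P P
  bounds : ∃ γ cmax : ℝ, 0 < γ ∧ 0 < cmax ∧ (∀ r ∈ spectrum ℝ A, cmax ≤ r / 2) ∧
    ∀ᵐ ω ∂P, ∀ k, (A + Matrix.of (Δ ω k)).PosDef ∧
      matSupport (Matrix.of (Δ ω k)) ⊆ matSupport A ∧
      (∀ i j, |(A + Matrix.of (Δ ω k))⁻¹ i j| ≤ γ) ∧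
      ‖Matrix.toEuclideanCLM (𝕜 := ℝ) (Matrix.of (Δ ω k))‖ ≤ cmax
  integrable_inv : ∀ k i j, Integrable (fun ω => (A + Matrix.of (Δ ω k))⁻¹ i j) P
  samples : ∃ law : Fin K → Matrix (Fin N) (Fin N) ℝ → Measure (EuclideanSpace ℝ (Fin N)),
    (∀ᵐ ω ∂P, ∀ k, IsSubGaussianVector (law k (A + Matrix.of (Δ ω k)))
      (A + Matrix.of (Δ ω k)) σ) ∧
    ∀ (B : Set (Fin K → Coupling N)) (C : Set (Data N K n)), MeasurableSet B → MeasurableSet C →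
      P (Δ ⁻¹' B ∩ X ⁻¹' C) = ∫⁻ ω in Δ ⁻¹' B,
        Measure.pi (fun k => Measure.pi fun _ : Fin n => law k (A + Matrix.of (Δ ω k))) C ∂P

/-- The centred Gaussian law with covariance `(I + H ⊙ Q)⁻¹`. -/
def gaussianLaw {N : ℕ} (d : ℕ) (π : Equiv.Perm (Fin N)) (q : Coupling N) :
    Measure (EuclideanSpace ℝ (Fin N)) :=
  multivariateGaussian 0 (precision d π q)⁻¹

/-- The random experiment: `π` is a uniform random permutation, the matrices `Q^(1), …, Q^(K)` are
independent of `π` and almost surely symmetric with entries in `[-1/(2d), 1/(2d)]` (their joint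
law is otherwise arbitrary; they may be deterministic), and given `π` and `Q` all samples are
independent, the `n` samples of task `k` being Gaussian with covariance `(I + H ⊙ Q^(k))⁻¹`. -/
structure IsExperiment {Ω : Type*} [MeasurableSpace Ω] {N K n : ℕ} (d : ℕ) (P : Measure Ω)
    (π : Ω → Equiv.Perm (Fin N)) (Q : Ω → Fin K → Coupling N) (X : Ω → Data N K n) : Prop where
  measurable_perm : Measurable π
  measurable_coupling : Measurable Q
  measurable_data : Measurable X
  uniform : ∀ τ : Equiv.Perm (Fin N), P {ω | π ω = τ} = ((N ! : ℕ) : ℝ≥0∞)⁻¹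
  indep : IndepFun π Q P
  mem_box : ∀ᵐ ω ∂P, ∀ k, Q ω k ∈ couplingBox N d
  samples : ∀ (τ : Equiv.Perm (Fin N)) (B : Set (Fin K → Coupling N)) (C : Set (Data N K n)),
    MeasurableSet B → MeasurableSet C →
      P ({ω | π ω = τ} ∩ Q ⁻¹' B ∩ X ⁻¹' C) = ∫⁻ ω in {ω | π ω = τ} ∩ Q ⁻¹' B,
        Measure.pi (fun k => Measure.pi fun _ : Fin n => gaussianLaw d τ (Q ω k)) C ∂P

/-- `S'` is an estimate of the support union: a measurable function of the data, possibly also of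
the matrices `Q^(k)` and of external randomness `U` independent of everything else. -/
structure IsEstimate {Ω 𝓤 : Type*} [MeasurableSpace Ω] [MeasurableSpace 𝓤] {N K n : ℕ}
    (P : Measure Ω) (π : Ω → Equiv.Perm (Fin N)) (Q : Ω → Fin K → Coupling N)
    (X : Ω → Data N K n) (U : Ω → 𝓤) (S' : Ω → Set (Fin N × Fin N)) : Prop where
  measurable_rand : Measurable U
  indep : IndepFun U (fun ω => (π ω, Q ω, X ω)) P
  factors : ∃ s : Data N K n × (Fin K → Coupling N) × 𝓤 → Set (Fin N × Fin N),
    Measurable s ∧ ∀ ω, S' ω = s (X ω, Q ω, U ω)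

end SupportUnion

end

/-
The law of the samples given the permutation is compared with the law of independent standard
Gaussians. Couplings bounded by `1/(2d)` keep the precision matrix above `I/2` (diagonal dominance)
and within squared Frobenius distance `N/(4d)` of `I`, so that each sample contributes at most
`N/(4d)` to the Kullback-Leibler divergence, and Fano's inequality bounds the success probability in
terms of the number of permutations with the same support `S`.

Two permutations have the same support exactly when they differ by an automorphism of the circulant
graph. For `d ≤ N - 3`, two positions are neighbours on the cycle exactly when their closed
neighbourhoods differ by one point, so an automorphism respects the cyclic order and there are at
most `2N` of them. For `d = N - 2` the graph is the complement of a perfect matching: an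
automorphism preserves antipodal pairs, hence is determined by its values on half of the positions.
-/

namespace SupportUnion

section Information

open InformationTheory

variable {α β : Type*} [MeasurableSpace α] [MeasurableSpace β]

lemma integral_le_toReal_klDiv_add_log {μ ν : Measure α} [IsProbabilityMeasure μ]
    [IsProbabilityMeasure ν] (hμν : klDiv μ ν ≠ ∞) {f : α → ℝ} (hfμ : Integrable f μ)
    (hfν : Integrable (fun x => Real.exp (f x)) ν) :
    ∫ x, f x ∂μ ≤ (klDiv μ ν).toReal + Real.log (∫ x, Real.exp (f x) ∂ν) := by
  obtain ⟨hac, hllr⟩ := klDiv_ne_top_iff.mp hμν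
  have := isProbabilityMeasure_tilted hfν
  have hgibbs := integral_llr_add_sub_measure_univ_nonneg
    (hac.trans (absolutelyContinuous_tilted hfν)) (integrable_llr_tilted_right hac hfμ hllr hfν)
  rw [integral_llr_tilted_right hac hfμ hfν hllr] at hgibbs
  rw [toReal_klDiv_of_measure_eq hac (by simp)]
  simp only [probReal_univ] at hgibbs
  linarith

lemma mul_measureReal_le_toReal_klDiv_add_log {μ ν : Measure α} [IsProbabilityMeasure μ]
    [IsProbabilityMeasure ν] (hμν : klDiv μ ν ≠ ∞) {A : Set α} (hA : MeasurableSet A) (t : ℝ) :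
    t * μ.real A ≤ (klDiv μ ν).toReal + Real.log (1 + (Real.exp t - 1) * ν.real A) := by
  have hexp : (fun x => Real.exp (A.indicator (fun _ => t) x)) =
      fun x => 1 + A.indicator (fun _ => Real.exp t - 1) x := by
    ext x
    by_cases hx : x ∈ A <;> simp [hx]
  have hind (s : ℝ) (ρ : Measure α) [IsFiniteMeasure ρ] : Integrable (A.indicator fun _ => s) ρ :=
    (integrable_const s).indicator hA
  have h := integral_le_toReal_klDiv_add_log hμν (hind t μ)
    (hexp ▸ (integrable_const 1).add (hind (Real.exp t - 1) ν))
  rw [hexp, integral_add (integrable_const 1) (hind _ ν), integral_indicator_const _ hA,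
    integral_indicator_const _ hA] at h
  simpa [mul_comm] using h

lemma sum_log_le_card_mul_log {ι : Type*} [Fintype ι] {x : ι → ℝ} (hx : ∀ i, 0 < x i) {y : ℝ}
    (hxy : ∑ i, x i ≤ Fintype.card ι * y) (hy : 0 < y) :
    ∑ i, Real.log (x i) ≤ Fintype.card ι * Real.log y := by
  have htangent (i : ι) : Real.log (x i) ≤ Real.log y + (x i / y - 1) := by
    rw [← sub_le_iff_le_add', ← Real.log_div (hx i).ne' hy.ne']
    exact Real.log_le_sub_one_of_pos (div_pos (hx i) hy)
  calc ∑ i, Real.log (x i)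
    _ ≤ ∑ i, (Real.log y + (x i / y - 1)) := Finset.sum_le_sum fun i _ => htangent i
    _ = Fintype.card ι * Real.log y + ((∑ i, x i) / y - Fintype.card ι) := by
      simp [Finset.sum_add_distrib, Finset.sum_div]
    _ ≤ Fintype.card ι * Real.log y := by
      have := (div_le_iff₀ hy).mpr hxy
      linarith

-- Fano's inequality: the variational formula of Donsker and Varadhan, for `log M` times the
-- indicator of `A i`, is averaged over `i` by concavity of the logarithm.
lemma log_mul_sum_measureReal_le {ι : Type*} [Fintype ι] {μ : ι → Measure α} {ν : Measure α}
    [∀ i, IsProbabilityMeasure (μ i)] [IsProbabilityMeasure ν] {I M : ℝ} (hI : 0 ≤ I)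
    (hμν : ∀ i, klDiv (μ i) ν ≤ ENNReal.ofReal I) (hM : 1 ≤ M) {A : ι → Set α}
    (hA : ∀ i, MeasurableSet (A i)) (hsum : M * ∑ i, ν.real (A i) ≤ Fintype.card ι) :
    Real.log M * ∑ i, (μ i).real (A i) ≤ Fintype.card ι * (I + Real.log 2) := by
  have hM0 : 0 < M := by linarith
  have hpos (i : ι) : 0 < 1 + (M - 1) * ν.real (A i) :=
    add_pos_of_pos_of_nonneg one_pos (mul_nonneg (by linarith) measureReal_nonneg)
  have hmean : ∑ i, (1 + (M - 1) * ν.real (A i)) ≤ Fintype.card ι * 2 := by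
    have := Finset.sum_nonneg fun i (_ : i ∈ Finset.univ) => measureReal_nonneg (μ := ν) (s := A i)
    rw [Finset.sum_add_distrib, ← Finset.mul_sum]
    simp only [Finset.sum_const, Finset.card_univ, nsmul_eq_mul, mul_one]
    linarith
  have hdv (i : ι) : Real.log M * (μ i).real (A i) ≤
      I + Real.log (1 + (M - 1) * ν.real (A i)) := by
    have hne : klDiv (μ i) ν ≠ ∞ := ((hμν i).trans_lt ENNReal.ofReal_lt_top).ne
    have h := mul_measureReal_le_toReal_klDiv_add_log hne (hA i) (Real.log M)
    rw [Real.exp_log hM0] at h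
    linarith [ENNReal.toReal_le_of_le_ofReal hI (hμν i)]
  calc Real.log M * ∑ i, (μ i).real (A i)
      ≤ ∑ i, (I + Real.log (1 + (M - 1) * ν.real (A i))) := by
        rw [Finset.mul_sum]
        exact Finset.sum_le_sum fun i _ => hdv i
    _ ≤ Fintype.card ι * (I + Real.log 2) := by
        rw [Finset.sum_add_distrib, Finset.sum_const, Finset.card_univ, nsmul_eq_mul, mul_add]
        gcongr
        exact sum_log_le_card_mul_log hpos hmean two_pos

lemma mul_sum_measureReal_eq_le {ι γ : Type*} [Fintype ι] [MeasurableSpace γ]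
    [MeasurableSingletonClass γ] (ν : Measure α) [IsProbabilityMeasure ν] {s : α → γ}
    (hs : Measurable s) (f : ι → γ) {M C : ℝ} (hf : ∀ c, M * {i | f i = c}.ncard ≤ C) :
    M * ∑ i, ν.real {x | s x = f i} ≤ C := by
  classical
  have hmeas (i : ι) : MeasurableSet {x | s x = f i} := hs (measurableSet_singleton (f i))
  have hind (i : ι) : Integrable ({x | s x = f i}.indicator (1 : α → ℝ)) ν :=
    (integrable_const 1).indicator (hmeas i)
  have hcount (x : α) :
      ∑ i, {x | s x = f i}.indicator (1 : α → ℝ) x = ({i | f i = s x}.ncard : ℝ) := by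
    simp [Set.indicator_apply, Set.ncard_eq_toFinset_card', eq_comm]
  calc M * ∑ i, ν.real {x | s x = f i}
      = ∫ x, M * ∑ i, {x | s x = f i}.indicator (1 : α → ℝ) x ∂ν := by
        rw [integral_const_mul, integral_finsetSum _ fun i _ => hind i]
        simp_rw [integral_indicator_one (hmeas _)]
    _ ≤ ∫ _, C ∂ν := by
        refine integral_mono ((integrable_finsetSum _ fun i _ => hind i).const_mul M)
          (integrable_const C) fun x => ?_
        simp only [hcount]
        exact hf (s x)
    _ = C := by rw [integral_const, probReal_univ, one_smul]

lemma klDiv_map_of_leftInverse {f : α → β} {g : β → α} (hf : Measurable f) (hg : Measurable g)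
    (hfg : Function.LeftInverse g f) (μ ν : Measure α) [IsFiniteMeasure μ] [IsFiniteMeasure ν] :
    klDiv (μ.map f) (ν.map f) = klDiv μ ν := by
  refine (klDiv_map_le μ ν hf).antisymm ?_
  simpa [Measure.map_map hg hf, hfg.id] using klDiv_map_le (μ.map f) (ν.map f) hg

lemma klDiv_prod (μ₁ ν₁ : Measure α) (μ₂ ν₂ : Measure β) [IsProbabilityMeasure μ₁]
    [IsFiniteMeasure ν₁] [IsProbabilityMeasure μ₂] [IsProbabilityMeasure ν₂] :
    klDiv (μ₁.prod μ₂) (ν₁.prod ν₂) = klDiv μ₁ ν₁ + klDiv μ₂ ν₂ := by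
  have hswap : klDiv (μ₁.prod μ₂) (μ₁.prod ν₂) = klDiv (μ₂.prod μ₁) (ν₂.prod μ₁) := by
    rw [← klDiv_map_of_leftInverse measurable_swap measurable_swap Prod.swap_swap]
    exact congr_arg₂ klDiv Measure.prod_swap Measure.prod_swap
  have h := klDiv_compProd_eq_add μ₁ ν₁ (Kernel.const α μ₂) (Kernel.const α ν₂)
  rw [Measure.compProd_const, Measure.compProd_const, Measure.compProd_const] at h
  rw [h, hswap, ← Measure.compProd_const, ← Measure.compProd_const, klDiv_compProd_left]

lemma klDiv_pi {n : ℕ} {α : Fin n → Type*} [∀ i, MeasurableSpace (α i)]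
    (μ ν : ∀ i, Measure (α i)) [∀ i, IsProbabilityMeasure (μ i)] [∀ i, IsProbabilityMeasure (ν i)] :
    klDiv (Measure.pi μ) (Measure.pi ν) = ∑ i, klDiv (μ i) (ν i) := by
  induction n with
  | zero =>
    rw [Measure.pi_of_empty μ, Measure.pi_of_empty ν]
    simp
  | succ n ih =>
    rw [← klDiv_map_of_leftInverse (MeasurableEquiv.piFinSuccAbove α 0).measurable
        (MeasurableEquiv.piFinSuccAbove α 0).symm.measurable
        (MeasurableEquiv.piFinSuccAbove α 0).symm_apply_apply,
      (measurePreserving_piFinSuccAbove μ 0).map_eq, (measurePreserving_piFinSuccAbove ν 0).map_eq,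
      klDiv_prod, ih, Fin.sum_univ_succ]
    rfl

end Information

section Real

open InformationTheory

variable (m : ℝ) {v w : ℝ≥0}

lemma gaussianReal_absolutelyContinuous_gaussianReal (hv : v ≠ 0) (hw : w ≠ 0) :
    gaussianReal m v ≪ gaussianReal m w :=
  (gaussianReal_absolutelyContinuous m hv).trans (gaussianReal_absolutelyContinuous' m hw)

lemma llr_gaussianReal (hv : v ≠ 0) (hw : w ≠ 0) :
    llr (gaussianReal m v) (gaussianReal m w) =ᵐ[gaussianReal m v] fun x =>
      (((w : ℝ)⁻¹ - (v : ℝ)⁻¹) * (x - m) ^ 2 - Real.log (v / w)) / 2 := by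
  have hac := gaussianReal_absolutelyContinuous m hv
  filter_upwards [(gaussianReal_absolutelyContinuous_gaussianReal m hv hw).ae_le
      (Measure.rnDeriv_eq_div hac (gaussianReal_absolutelyContinuous m hw)),
    hac.ae_le (rnDeriv_gaussianReal m v), hac.ae_le (rnDeriv_gaussianReal m w)] with x hx hxv hxw
  have hv0 : (0 : ℝ) < v := by positivity
  have hw0 : (0 : ℝ) < w := by positivity
  simp only [llr_def]
  rw [hx, hxv, hxw, ENNReal.toReal_div, toReal_gaussianPDF, toReal_gaussianPDF,
    Real.log_div (gaussianPDFReal_pos m v x hv).ne' (gaussianPDFReal_pos m w x hw).ne',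
    gaussianPDFReal, gaussianPDFReal, Real.log_mul (by positivity) (by positivity),
    Real.log_mul (by positivity) (by positivity), Real.log_inv, Real.log_inv, Real.log_exp,
    Real.log_exp, Real.log_sqrt (by positivity), Real.log_sqrt (by positivity),
    Real.log_mul (by positivity) hv0.ne', Real.log_mul (by positivity) hw0.ne',
    Real.log_div hv0.ne' hw0.ne']
  field_simp
  ring

lemma integrable_sq_sub_gaussianReal : Integrable (fun x => (x - m) ^ 2) (gaussianReal m v) :=
  ((memLp_id_gaussianReal 2).sub (memLp_const m)).integrable_sq

lemma integral_sq_sub_gaussianReal : ∫ x, (x - m) ^ 2 ∂gaussianReal m v = v := by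
  rw [← variance_fun_id_gaussianReal (μ := m), variance_eq_integral (by fun_prop),
    integral_id_gaussianReal]

lemma klDiv_gaussianReal (hv : v ≠ 0) (hw : w ≠ 0) :
    klDiv (gaussianReal m v) (gaussianReal m w) =
      ENNReal.ofReal ((v / w - 1 - Real.log (v / w)) / 2) := by
  have hllr := llr_gaussianReal m hv hw
  have hsq := (integrable_sq_sub_gaussianReal m (v := v)).const_mul ((w : ℝ)⁻¹ - (v : ℝ)⁻¹)
  rw [klDiv_of_ac_of_integrable (gaussianReal_absolutelyContinuous_gaussianReal m hv hw)
      (((hsq.sub (integrable_const _)).div_const 2).congr hllr.symm), integral_congr_ae hllr,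
    integral_div, integral_sub hsq (integrable_const _), integral_const_mul,
    integral_sq_sub_gaussianReal]
  have : (v : ℝ) ≠ 0 := by exact_mod_cast hv
  simp only [integral_const, probReal_univ, one_smul, add_sub_cancel_right]
  congr 2
  field_simp

end Real

section Multivariate

open InformationTheory

lemma charFun_map_linearIsometryEquiv {E F : Type*} [NormedAddCommGroup E] [InnerProductSpace ℝ E]
    [MeasurableSpace E] [BorelSpace E] [NormedAddCommGroup F] [InnerProductSpace ℝ F]
    [MeasurableSpace F] [BorelSpace F] (μ : Measure E) (f : E ≃ₗᵢ[ℝ] F) (t : F) :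
    charFun (μ.map f) t = charFun μ (f.symm t) := by
  rw [charFun_apply, charFun_apply,
    integral_map f.continuous.measurable.aemeasurable (by fun_prop)]
  simp [f.inner_map_eq_flip]

lemma dotProduct_mulVec_eigenvectorBasis_repr_symm {ι : Type*} [Fintype ι] [DecidableEq ι]
    {S : Matrix ι ι ℝ} (hS : S.IsHermitian) (t : EuclideanSpace ℝ ι) :
    (hS.eigenvectorBasis.repr.symm t).ofLp ⬝ᵥ S *ᵥ (hS.eigenvectorBasis.repr.symm t).ofLp =
      ∑ i, hS.eigenvalues i * t i ^ 2 := by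
  set b := hS.eigenvectorBasis
  set s : EuclideanSpace ℝ ι := WithLp.toLp 2 fun i => hS.eigenvalues i * t i
  have hmul : WithLp.toLp 2 (S *ᵥ (b.repr.symm t).ofLp) = b.repr.symm s := by
    simp only [← b.sum_repr_symm, WithLp.ofLp_sum, Matrix.mulVec_sum, WithLp.toLp_sum,
      WithLp.ofLp_smul, Matrix.mulVec_smul, b, hS.mulVec_eigenvectorBasis, smul_smul, s,
      WithLp.toLp_smul, WithLp.toLp_ofLp, mul_comm]
  have hinner := b.repr.symm.inner_map_map s t
  rw [← hmul, EuclideanSpace.inner_eq_star_dotProduct, EuclideanSpace.inner_eq_star_dotProduct]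
    at hinner
  simpa [dotProduct, s, sq, mul_assoc, mul_left_comm] using hinner

lemma map_eigenvectorBasis_repr_multivariateGaussian {ι : Type*} [Fintype ι] [DecidableEq ι]
    {S : Matrix ι ι ℝ} (hS : S.PosSemidef) :
    (multivariateGaussian 0 S).map hS.1.eigenvectorBasis.repr =
      (Measure.pi fun i => gaussianReal 0 (hS.1.eigenvalues i).toNNReal).map (WithLp.toLp 2) := by
  have := Measure.isProbabilityMeasure_map (μ := multivariateGaussian 0 S)
    hS.1.eigenvectorBasis.repr.continuous.measurable.aemeasurable
  have := Measure.isProbabilityMeasure_map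
    (μ := Measure.pi fun i => gaussianReal 0 (hS.1.eigenvalues i).toNNReal)
    (PiLp.continuous_toLp 2 _).measurable.aemeasurable
  refine Measure.ext_of_charFun (funext fun t => ?_)
  rw [charFun_map_linearIsometryEquiv, charFun_multivariateGaussian hS, charFun_pi,
    dotProduct_mulVec_eigenvectorBasis_repr_symm]
  simp_rw [charFun_gaussianReal]
  rw [← Complex.exp_sum]
  congr 1
  simp [hS.eigenvalues_nonneg, Finset.sum_div, ← Finset.sum_neg_distrib]

lemma klDiv_multivariateGaussian_stdGaussian {N : ℕ} {S : Matrix (Fin N) (Fin N) ℝ}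
    (hS : S.PosDef) :
    klDiv (multivariateGaussian 0 S) (stdGaussian (EuclideanSpace ℝ (Fin N))) =
      ENNReal.ofReal ((S.trace - N - Real.log S.det) / 2) := by
  have hpos := hS.eigenvalues_pos
  have hterm (i : Fin N) : 0 ≤ (hS.1.eigenvalues i - 1 - Real.log (hS.1.eigenvalues i)) / 2 := by
    linarith [Real.log_le_sub_one_of_pos (hpos i)]
  rw [← klDiv_map_of_leftInverse (f := hS.posSemidef.1.eigenvectorBasis.repr)
      (LinearIsometryEquiv.continuous _).measurable (LinearIsometryEquiv.continuous _).measurable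
      (LinearIsometryEquiv.symm_apply_apply _), stdGaussian_map, ← map_pi_eq_stdGaussian,
    map_eigenvectorBasis_repr_multivariateGaussian hS.posSemidef,
    klDiv_map_of_leftInverse (PiLp.continuous_toLp 2 _).measurable
      (PiLp.continuous_ofLp 2 _).measurable fun _ => rfl, klDiv_pi]
  simp_rw [fun i => klDiv_gaussianReal 0 (Real.toNNReal_pos.2 (hpos i)).ne' one_ne_zero]
  simp only [Real.coe_toNNReal _ (hpos _).le, NNReal.coe_one, div_one]
  rw [← ENNReal.ofReal_sum_of_nonneg fun i _ => hterm i, ← Finset.sum_div, Finset.sum_sub_distrib,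
    Finset.sum_sub_distrib, ← Real.log_prod fun i _ => (hpos i).ne',
    hS.1.trace_eq_sum_eigenvalues, hS.1.det_eq_prod_eigenvalues]
  simp

end Multivariate

section PosSemidef

lemma abs_apply_le_half_add {ι : Type*} {S : Matrix ι ι ℝ} (hS : S.PosSemidef) (i j : ι) :
    |S i j| ≤ (S i i + S j j) / 2 := by
  have hsymm : S j i = S i j := by simpa using hS.1.apply i j
  have hform (c : ℝ) : 0 ≤ S i i + S i j * c + c * (S i j + S j j * c) := by
    simpa [Matrix.mulVec, dotProduct, Fin.sum_univ_two, hsymm] using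
      (hS.submatrix ![i, j]).dotProduct_mulVec_nonneg ![1, c]
  exact abs_le.2 ⟨by linarith [hform 1], by linarith [hform (-1)]⟩

variable {ι : Type*} [DecidableEq ι] {A : Matrix ι ι ℝ} {m : ℝ}

lemma posDef_of_posSemidef_sub_smul_one (hm : 0 < m) (hA : (A - m • 1).PosSemidef) :
    A.PosDef := by
  simpa using Matrix.PosDef.posSemidef_add hA (Matrix.PosDef.one.smul hm)

variable [Fintype ι]

lemma posSemidef_inv_smul_one_sub_inv (hm : 0 < m) (hA : (A - m • 1).PosSemidef) :
    (m⁻¹ • 1 - A⁻¹).PosSemidef := by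
  have hpos := posDef_of_posSemidef_sub_smul_one hm hA
  have hdet := hpos.det_pos.ne'.isUnit
  have hcongr : m⁻¹ • (1 : Matrix ι ι ℝ) - A⁻¹ =
      A⁻¹ᴴ * (m⁻¹ • ((A - m • 1)ᴴ * (A - m • 1)) + (A - m • 1)) * A⁻¹ := by
    rw [hpos.inv.1.eq, hA.1.eq]
    have hsq : m⁻¹ • ((A - m • 1) * (A - m • 1)) + (A - m • 1) = A * (m⁻¹ • A - 1) := by
      simp only [mul_sub, sub_mul, Matrix.mul_smul, Matrix.smul_mul, mul_one, one_mul, smul_sub,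
        smul_smul, inv_mul_cancel₀ hm.ne', inv_mul_cancel_left₀ hm.ne', one_smul]
      abel
    rw [hsq, Matrix.nonsing_inv_mul_cancel_left _ _ hdet, sub_mul, Matrix.smul_mul,
      Matrix.mul_nonsing_inv _ hdet, one_mul]
  rw [hcongr]
  exact (((Matrix.posSemidef_conjTranspose_mul_self _).smul (by positivity)).add
    hA).conjTranspose_mul_mul_same _

lemma abs_inv_apply_le (hm : 0 < m) (hA : (A - m • 1).PosSemidef) (i j : ι) :
    |A⁻¹ i j| ≤ m⁻¹ := by
  have hdiag (i : ι) : A⁻¹ i i ≤ m⁻¹ := by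
    simpa using (posSemidef_inv_smul_one_sub_inv hm hA).diag_nonneg (i := i)
  have := abs_apply_le_half_add (posDef_of_posSemidef_sub_smul_one hm hA).inv.posSemidef i j
  linarith [hdiag i, hdiag j]

lemma log_det_le_trace_sub_card (hA : A.PosDef) :
    Real.log A.det ≤ A.trace - Fintype.card ι := by
  rw [hA.isHermitian.det_eq_prod_eigenvalues, hA.isHermitian.trace_eq_sum_eigenvalues]
  simp only [RCLike.ofReal_real_eq_id, id]
  rw [Real.log_prod fun i _ => (hA.eigenvalues_pos i).ne']
  calc ∑ i, Real.log (hA.isHermitian.eigenvalues i)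
    _ ≤ ∑ i, (hA.isHermitian.eigenvalues i - 1) :=
      Finset.sum_le_sum fun i _ => Real.log_le_sub_one_of_pos (hA.eigenvalues_pos i)
    _ = ∑ i, hA.isHermitian.eigenvalues i - Fintype.card ι := by simp

lemma trace_inv_add_trace_le (hm : 0 < m) (hA : (A - m • 1).PosSemidef) :
    A⁻¹.trace + A.trace - 2 * Fintype.card ι ≤ m⁻¹ * ∑ i, ∑ j, (A - 1) i j ^ 2 := by
  have hpos := posDef_of_posSemidef_sub_smul_one hm hA
  have hdet := hpos.det_pos.ne'.isUnit
  have hsymm : (A - 1)ᴴ = A - 1 := (hpos.1.sub Matrix.isHermitian_one).eq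
  have hexpand : (A - 1)ᴴ * A⁻¹ * (A - 1) = A⁻¹ + A - (1 + 1) := by
    rw [hsymm, sub_mul, Matrix.mul_nonsing_inv _ hdet, one_mul, mul_sub, sub_mul, sub_mul,
      Matrix.nonsing_inv_mul _ hdet]
    simp only [one_mul, mul_one]
    abel
  have hfrob : ((A - 1)ᴴ * (A - 1)).trace = ∑ i, ∑ j, (A - 1) i j ^ 2 := by
    rw [Finset.sum_comm]
    simp only [Matrix.trace, Matrix.diag, Matrix.mul_apply, Matrix.conjTranspose_apply,
      star_trivial, sq]
  have h := ((posSemidef_inv_smul_one_sub_inv hm hA).conjTranspose_mul_mul_same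
    (A - 1)).trace_nonneg
  rw [mul_sub (A - 1)ᴴ, sub_mul, hexpand, Matrix.mul_smul, mul_one, Matrix.smul_mul,
    Matrix.trace_sub, Matrix.trace_sub, Matrix.trace_add, Matrix.trace_add, Matrix.trace_one,
    Matrix.trace_smul, hfrob, smul_eq_mul] at h
  linarith

lemma posSemidef_of_sum_erase_abs_le (hA : A.IsHermitian)
    (hrow : ∀ i, ∑ j ∈ Finset.univ.erase i, |A i j| ≤ A i i) : A.PosSemidef := by
  refine hA.posSemidef_iff_eigenvalues_nonneg.2 fun i => ?_
  have hev : Module.End.HasEigenvalue A.toLin' (hA.eigenvalues i) := by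
    rw [Module.End.hasEigenvalue_iff_mem_spectrum, Matrix.spectrum_toLin']
    exact hA.eigenvalues_mem_spectrum_real i
  obtain ⟨k, hk⟩ := eigenvalue_mem_ball hev
  rw [mem_closedBall_iff_norm, Real.norm_eq_abs] at hk
  have := hk.trans (hrow k)
  simp only [Pi.zero_apply]
  linarith [(abs_le.1 this).1]

end PosSemidef

open InformationTheory in
lemma klDiv_multivariateGaussian_inv_le {N : ℕ} {A : Matrix (Fin N) (Fin N) ℝ} {m : ℝ}
    (hm : 0 < m) (hA : (A - m • 1).PosSemidef) :
    klDiv (multivariateGaussian 0 A⁻¹) (stdGaussian (EuclideanSpace ℝ (Fin N))) ≤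
      ENNReal.ofReal ((∑ i, ∑ j, (A - 1) i j ^ 2) / (2 * m)) := by
  have hpos := posDef_of_posSemidef_sub_smul_one hm hA
  rw [klDiv_multivariateGaussian_stdGaussian hpos.inv, Matrix.det_nonsing_inv,
    Ring.inverse_eq_inv', Real.log_inv]
  refine ENNReal.ofReal_le_ofReal ?_
  have hlog := log_det_le_trace_sub_card hpos
  have htrace := trace_inv_add_trace_le hm hA
  have hdiv : (∑ i, ∑ j, (A - 1) i j ^ 2) / (2 * m) = m⁻¹ * (∑ i, ∑ j, (A - 1) i j ^ 2) / 2 := by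
    field_simp
  rw [Fintype.card_fin] at hlog htrace
  linarith

section Measurability

lemma isClosed_posSemidef {ι : Type*} [Finite ι] :
    IsClosed {q : ι → ι → ℝ | (Matrix.of q).PosSemidef} := by
  have := Fintype.ofFinite ι
  simp only [Matrix.posSemidef_iff_dotProduct_mulVec, Set.ofPred_and, Set.ofPred_forall]
  have hof : Continuous fun q : ι → ι → ℝ => Matrix.of q := continuous_id
  exact (isClosed_eq hof.matrix_conjTranspose hof).inter <| isClosed_iInter fun x =>
    isClosed_le continuous_const (continuous_const.dotProduct (hof.matrix_mulVec continuous_const))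

variable {α ι : Type*} [MeasurableSpace α] [Fintype ι]

lemma measurable_measure_pi {E : ι → Type*} [∀ i, MeasurableSpace (E i)]
    {μ : α → ∀ i, Measure (E i)} [∀ a i, IsProbabilityMeasure (μ a i)]
    (hμ : ∀ i, Measurable fun a => μ a i) : Measurable fun a => Measure.pi (μ a) := by
  refine Measurable.measure_of_isPiSystem_of_isProbabilityMeasure generateFrom_pi.symm
    isPiSystem_pi ?_
  rintro _ ⟨s, hs, rfl⟩
  simp only [Measure.pi_pi]
  exact Finset.measurable_fun_prod _ fun i _ =>
    (Measure.measurable_coe (hs i (Set.mem_univ i))).comp (hμ i)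

variable [DecidableEq ι]

open scoped Matrix.Norms.L2Operator MatrixOrder

lemma continuousOn_toEuclideanCLM_sqrt :
    ContinuousOn (fun p : (ι → ι → ℝ) × EuclideanSpace ℝ ι =>
      Matrix.toEuclideanCLM (𝕜 := ℝ) (CFC.sqrt (Matrix.of p.1)) p.2)
      {p | (Matrix.of p.1).PosSemidef} := by
  have hclm : Continuous (Matrix.toEuclideanCLM (𝕜 := ℝ) (n := ι)) :=
    LinearMap.continuous_of_finiteDimensional
      (AlgHomClass.toAlgHom (Matrix.toEuclideanCLM (𝕜 := ℝ) (n := ι))).toLinearMap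
  have hsqrt : ContinuousOn (fun p : (ι → ι → ℝ) × EuclideanSpace ℝ ι =>
      CFC.sqrt (Matrix.of p.1)) {p | (Matrix.of p.1).PosSemidef} :=
    CFC.continuousOn_sqrt.comp continuous_fst.continuousOn fun p hp =>
      Matrix.nonneg_iff_posSemidef.2 hp
  exact (hclm.comp_continuousOn hsqrt).clm_apply continuousOn_snd

lemma measurable_toEuclideanCLM_sqrt :
    Measurable fun p : (ι → ι → ℝ) × EuclideanSpace ℝ ι =>
      Matrix.toEuclideanCLM (𝕜 := ℝ) (CFC.sqrt (Matrix.of p.1)) p.2 := by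
  classical
  have hzero (q : ι → ι → ℝ) (hq : ¬ (Matrix.of q).PosSemidef) : CFC.sqrt (Matrix.of q) = 0 :=
    cfcₙ_apply_of_not_predicate _ (Matrix.nonneg_iff_posSemidef.not.2 hq)
  convert! continuousOn_toEuclideanCLM_sqrt.measurable_piecewise
    (continuousOn_const (c := (0 : EuclideanSpace ℝ ι)))
    (isClosed_posSemidef.preimage continuous_fst).measurableSet using 1
  ext1 p
  by_cases hp : (Matrix.of p.1).PosSemidef
  · simp [hp]
  · simp [hp, hzero]

lemma measurable_multivariateGaussian_zero :
    Measurable fun q : ι → ι → ℝ => multivariateGaussian 0 (Matrix.of q) := by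
  refine Measure.measurable_of_measurable_coe _ fun s hs => ?_
  simp only [multivariateGaussian, zero_add, Measure.map_apply
    (Matrix.toEuclideanCLM (𝕜 := ℝ) _).continuous.measurable hs]
  exact measurable_measure_prodMk_left (measurable_toEuclideanCLM_sqrt hs)

lemma measurable_inv_apply (i j : ι) : Measurable fun q : ι → ι → ℝ => (Matrix.of q)⁻¹ i j := by
  simp only [Matrix.inv_def, Matrix.smul_apply, Ring.inverse_eq_inv', smul_eq_mul]
  have hof : Continuous fun q : ι → ι → ℝ => Matrix.of q := continuous_id
  exact hof.matrix_det.measurable.inv.mul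
    ((continuous_apply_apply i j).comp hof.matrix_adjugate).measurable

end Measurability

section Coordinates

variable {N : ℕ}

lemma memLp_eval_multivariateGaussian_zero (S : Matrix (Fin N) (Fin N) ℝ) (i : Fin N) :
    MemLp (fun x : EuclideanSpace ℝ (Fin N) => x i) 2 (multivariateGaussian 0 S) :=
  (IsGaussian.memLp_two_id (μ := multivariateGaussian 0 S)).continuousLinearMap_comp
    (EuclideanSpace.proj (𝕜 := ℝ) i)

lemma integral_eval_multivariateGaussian_zero (S : Matrix (Fin N) (Fin N) ℝ) (i : Fin N) :
    ∫ x, x i ∂multivariateGaussian 0 S = 0 := by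
  simpa using (EuclideanSpace.proj (𝕜 := ℝ) i).integral_comp_id_comm
    (IsGaussian.integrable_id (μ := multivariateGaussian (0 : EuclideanSpace ℝ (Fin N)) S))

lemma map_eval_div_sqrt_multivariateGaussian_zero {S : Matrix (Fin N) (Fin N) ℝ}
    (hS : S.PosDef) (i : Fin N) :
    (multivariateGaussian 0 S).map
      (fun x : EuclideanSpace ℝ (Fin N) => x i / Real.sqrt (S i i)) = gaussianReal 0 1 := by
  have hv : 0 < S i i := hS.diag_pos
  have hdiv := gaussianReal_map_div_const (μ := 0) (v := (S i i).toNNReal) (Real.sqrt (S i i))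
  have heval := (measurePreserving_eval_multivariateGaussian (μ := 0) hS.posSemidef
    (i := i)).map_eq
  rw [PiLp.zero_apply] at heval
  rw [← heval, Measure.map_map (by fun_prop) (by fun_prop), zero_div] at hdiv
  refine hdiv.trans (congrArg _ (NNReal.eq ?_))
  rw [NNReal.coe_div, Real.coe_toNNReal _ hv.le, NNReal.coe_mk, Real.sq_sqrt hv.le,
    div_self hv.ne', NNReal.coe_one]

lemma isSubGaussianVector_multivariateGaussian {A : Matrix (Fin N) (Fin N) ℝ} (hA : A.PosDef)
    {σ : ℝ≥0} (hσ : 1 ≤ σ) : IsSubGaussianVector (multivariateGaussian 0 A⁻¹) A σ where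
  isProbabilityMeasure := inferInstance
  posDef := hA
  memLp := memLp_eval_multivariateGaussian_zero A⁻¹
  mean := integral_eval_multivariateGaussian_zero A⁻¹
  covariance := covariance_eval_multivariateGaussian hA.inv.posSemidef
  subGaussian i := by
    have hmap := map_eval_div_sqrt_multivariateGaussian_zero hA.inv i
    refine ⟨fun t => ?_, fun t => ?_⟩
    · have hexp := integrable_exp_mul_gaussianReal (μ := 0) (v := 1) t
      rwa [← hmap, integrable_map_measure (by fun_prop) (by fun_prop)] at hexp
    · have hσ2 : (1 : ℝ) ≤ (σ : ℝ) ^ 2 := one_le_pow₀ (by exact_mod_cast hσ)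
      rw [mgf_gaussianReal hmap, Real.exp_le_exp]
      push_cast
      nlinarith [mul_le_mul_of_nonneg_right hσ2 (sq_nonneg t)]

end Coordinates

section Graph

/-- The residue `v` is within distance `k` of `0` on the cycle of length `N`. -/
def Near {N : ℕ} (k : ℕ) (v : Fin N) : Prop := v.val ≤ k ∨ N ≤ v.val + k

lemma val_sub_eq_ite {N : ℕ} (a b : Fin N) :
    (a - b).val = if b.val ≤ a.val then a.val - b.val else N + a.val - b.val := by
  split_ifs with hab
  · exact Fin.coe_sub_iff_le.2 hab
  · exact Fin.coe_sub_iff_lt.2 (not_le.1 hab)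

lemma eq_cyclicShift_iff {N : ℕ} (i j : Fin N) {m : ℕ} (hm : m < N) :
    j = cyclicShift i m ↔ (j - i).val = m := by
  rw [val_sub_eq_ite, Fin.ext_iff, cyclicShift]
  by_cases h : i.val + m < N
  · simp only [Nat.mod_eq_of_lt h]
    split_ifs <;> omega
  · have hmod : (i.val + m) % N = i.val + m - N := by
      rw [Nat.mod_eq_sub_mod (by omega), Nat.mod_eq_of_lt (by omega)]
    simp only [hmod]
    split_ifs <;> omega

lemma mem_edgeSet_iff {N d : ℕ} (hd : d / 2 < N) (π : Equiv.Perm (Fin N)) (i j : Fin N) :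
    (π i, π j) ∈ edgeSet d π ↔ i ≠ j ∧ Near (d / 2) (j - i) := by
  simp only [edgeSet, Set.mem_ofPred_eq, Prod.mk.injEq, EmbeddingLike.apply_eq_iff_eq, Near, Ne,
    Fin.ext_iff (a := i) (b := j)]
  constructor
  · rintro ⟨a, m, hm1, hm2, ⟨rfl, h⟩ | ⟨h, rfl⟩⟩ <;>
    · rw [eq_cyclicShift_iff _ _ (by omega), val_sub_eq_ite] at h
      rw [val_sub_eq_ite]
      split_ifs at h ⊢ <;> omega
  · rintro ⟨hij, h | h⟩ <;> rw [val_sub_eq_ite] at h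
    · refine ⟨i, (j - i).val, ?_, ?_, Or.inl ⟨rfl, (eq_cyclicShift_iff _ _ (j - i).isLt).2 rfl⟩⟩ <;>
      · rw [val_sub_eq_ite]
        split_ifs at h ⊢ <;> omega
    · refine ⟨j, (i - j).val, ?_, ?_, Or.inr ⟨(eq_cyclicShift_iff _ _ (i - j).isLt).2 rfl, rfl⟩⟩ <;>
      · rw [val_sub_eq_ite]
        split_ifs at h ⊢ <;> omega

lemma mem_edgeSet_iff_symm {N d : ℕ} (hd : d / 2 < N) (π : Equiv.Perm (Fin N)) (a b : Fin N) :
    (a, b) ∈ edgeSet d π ↔ a ≠ b ∧ Near (d / 2) (π.symm b - π.symm a) := by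
  simpa using mem_edgeSet_iff hd π (π.symm a) (π.symm b)

lemma mem_supportUnion_iff {N d : ℕ} (hd : d / 2 < N) (π : Equiv.Perm (Fin N)) (a b : Fin N) :
    (a, b) ∈ supportUnion d π ↔ Near (d / 2) (π.symm b - π.symm a) := by
  have : NeZero N := ⟨by omega⟩
  rw [supportUnion, Set.mem_union, mem_edgeSet_iff_symm hd, Set.mem_ofPred_eq]
  by_cases hab : a = b
  · simp [hab, Near]
  · simp [hab]

lemma ncard_ne_zero_near {N k : ℕ} (hk : 2 * k < N) :
    {v : Fin N | v.val ≠ 0 ∧ Near k v}.ncard = 2 * k := by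
  have himage : Fin.val '' {v : Fin N | v.val ≠ 0 ∧ Near k v} =
      (Finset.Icc 1 k ∪ Finset.Ico (N - k) N : Finset ℕ) := by
    ext m
    simp only [Set.mem_image, Set.mem_ofPred_eq, Near, Finset.coe_union, Finset.coe_Icc,
      Finset.coe_Ico, Set.mem_union, Set.mem_Icc, Set.mem_Ico]
    exact ⟨by rintro ⟨v, hv, rfl⟩; omega, fun hm => ⟨⟨m, by omega⟩, by grind, rfl⟩⟩
  have hdisj : Disjoint (Finset.Icc 1 k) (Finset.Ico (N - k) N) := by
    simp only [Finset.disjoint_left, Finset.mem_Icc, Finset.mem_Ico]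
    omega
  rw [← Set.ncard_image_of_injective _ Fin.val_injective, himage, Set.ncard_coe_finset,
    Finset.card_union_of_disjoint hdisj, Nat.card_Icc, Nat.card_Ico]
  omega

lemma ncard_neighbours {N d : ℕ} (hd2 : Even d) (hd : d < N) (π : Equiv.Perm (Fin N))
    (a : Fin N) : {b | (a, b) ∈ edgeSet d π}.ncard = d := by
  have : NeZero N := ⟨by omega⟩
  have himage : {b | (a, b) ∈ edgeSet d π} =
      (fun v => π (π.symm a + v)) '' {v : Fin N | v.val ≠ 0 ∧ Near (d / 2) v} := by
    ext b
    simp only [Set.mem_ofPred_eq, mem_edgeSet_iff_symm (by omega : d / 2 < N), Set.mem_image,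
      Fin.val_ne_zero_iff]
    constructor
    · rintro ⟨hab, hnear⟩
      exact ⟨π.symm b - π.symm a, ⟨by simpa [sub_eq_zero] using hab.symm, hnear⟩, by simp⟩
    · rintro ⟨v, ⟨hv, hnear⟩, rfl⟩
      exact ⟨by simpa [← Equiv.symm_apply_eq] using hv, by simpa using hnear⟩
  have hinj : Function.Injective fun v => π (π.symm a + v) :=
    π.injective.comp (add_right_injective _)
  rw [himage, Set.ncard_image_of_injective _ hinj, ncard_ne_zero_near (by omega),
    Nat.two_mul_div_two_of_even hd2]

/-- The automorphisms of the circulant graph on `Fin N` in which two positions are joined when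
their cyclic distance is at most `k`. -/
def circulantAut (N k : ℕ) : Set (Equiv.Perm (Fin N)) :=
  {ρ | ∀ i j, Near k (ρ j - ρ i) ↔ Near k (j - i)}

lemma ncard_supportUnion_eq_le {N d : ℕ} (hd : d / 2 < N) (S : Set (Fin N × Fin N)) :
    {τ : Equiv.Perm (Fin N) | supportUnion d τ = S}.ncard ≤ (circulantAut N (d / 2)).ncard := by
  obtain h | ⟨τ₀, hτ₀⟩ := {τ : Equiv.Perm (Fin N) | supportUnion d τ = S}.eq_empty_or_nonempty
  · simp [h]
  refine Set.ncard_le_ncard_of_injOn (fun τ => τ.trans τ₀.symm) (fun τ hτ i j => ?_)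
    (fun τ _ τ' _ h => by ext1 i; simpa using DFunLike.congr_fun h i)
  rw [Equiv.trans_apply, Equiv.trans_apply, ← mem_supportUnion_iff hd, hτ₀.trans hτ.symm,
    mem_supportUnion_iff hd, Equiv.symm_apply_apply, Equiv.symm_apply_apply]

section Dihedral

open scoped Fin.CommRing

variable {N k : ℕ} [NeZero N] {ρ : Equiv.Perm (Fin N)}

lemma eq_one_or_eq_neg_one_iff (hN : 2 ≤ N) (v : Fin N) :
    v = 1 ∨ v = -1 ↔ v.val = 1 ∨ v.val + 1 = N := by
  have hone : (1 : Fin N).val = 1 := by rw [Fin.val_one', Nat.mod_eq_of_lt hN]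
  have hneg : (-1 : Fin N).val = N - 1 := by
    rw [← zero_sub, val_sub_eq_ite, hone, Fin.val_zero]
    simp
  rw [Fin.ext_iff, Fin.ext_iff, hone, hneg]
  omega

-- Both points lie at the far end of the arc when its translate by `v` overlaps it at one end only,
-- and otherwise just beyond the front end of that translate, which covers both ends of the arc.
omit [NeZero N] in
lemma nontrivial_near_diff (hk : 1 ≤ k) (hN : 2 * k + 3 ≤ N) {v : Fin N} (hv : 2 ≤ v.val)
    (hv' : v.val + 2 ≤ N) : {x | Near k x ∧ ¬ Near k (x - v)}.Nontrivial := by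
  simp only [Set.Nontrivial, Set.mem_ofPred_eq, Near, val_sub_eq_ite]
  by_cases hvk : v.val + 2 * k + 1 ≤ N
  · refine ⟨⟨N - k, by omega⟩, by grind,
      ⟨if k = 1 then 0 else N - k + 1, by grind⟩, by grind, by grind⟩
  · refine ⟨⟨if v.val + k + 1 < N then v.val + k + 1 else v.val + k + 1 - N, by grind⟩, by grind,
      ⟨if v.val + k + 2 < N then v.val + k + 2 else v.val + k + 2 - N, by grind⟩, by grind,
      by grind⟩

lemma subsingleton_near_diff_iff (hk : 1 ≤ k) (hN : 2 * k + 3 ≤ N) {v : Fin N} (hv : v ≠ 0) :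
    {x | Near k x ∧ ¬ Near k (x - v)}.Subsingleton ↔ v = 1 ∨ v = -1 := by
  rw [eq_one_or_eq_neg_one_iff (by omega)]
  constructor
  · intro hsub
    by_contra hstep
    have hv0 := Fin.val_ne_zero_iff.2 hv
    exact Set.not_subsingleton_iff.2 (nontrivial_near_diff hk hN (by omega) (by omega)) hsub
  · simp only [Set.Subsingleton, Set.mem_ofPred_eq, Near, val_sub_eq_ite]
    intro hstep x hx y hy
    grind

lemma sub_eq_one_or_neg_one_of_mem_circulantAut (hρ : ρ ∈ circulantAut N k) (hk : 1 ≤ k)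
    (hN : 2 * k + 3 ≤ N) {i j : Fin N} (hij : j - i = 1 ∨ j - i = -1) :
    ρ j - ρ i = 1 ∨ ρ j - ρ i = -1 := by
  have hne : i ≠ j := by
    rintro rfl
    rw [sub_self, eq_one_or_eq_neg_one_iff (by omega), Fin.val_zero] at hij
    omega
  have hsub := (subsingleton_near_diff_iff hk hN (sub_ne_zero.2 hne.symm)).2 hij
  refine (subsingleton_near_diff_iff hk hN (sub_ne_zero.2 (ρ.injective.ne hne.symm))).1 ?_
  have hnear (z : Fin N) : Near k z ↔ Near k (ρ.symm (z + ρ i) - i) := by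
    rw [← hρ, Equiv.apply_symm_apply, add_sub_cancel_right]
  have hnear' (z : Fin N) : Near k (z - (ρ j - ρ i)) ↔
      Near k (ρ.symm (z + ρ i) - i - (j - i)) := by
    rw [sub_sub_sub_cancel_right, ← hρ _ (ρ.symm _), Equiv.apply_symm_apply, sub_sub_eq_add_sub]
  intro x hx y hy
  rw [Set.mem_ofPred_eq, hnear, hnear'] at hx hy
  simpa using hsub hx hy

lemma sub_eq_sub_of_mem_circulantAut (hρ : ρ ∈ circulantAut N k) (hk : 1 ≤ k)
    (hN : 2 * k + 3 ≤ N) (i : Fin N) : ρ (i + 1 + 1) - ρ (i + 1) = ρ (i + 1) - ρ i := by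
  have h₁ := sub_eq_one_or_neg_one_of_mem_circulantAut hρ hk hN
    (Or.inl (add_sub_cancel_left (i + 1) 1))
  have h₀ := sub_eq_one_or_neg_one_of_mem_circulantAut hρ hk hN
    (Or.inl (add_sub_cancel_left i 1))
  by_contra hne
  have hturn : ρ (i + 1 + 1) - ρ (i + 1) = -(ρ (i + 1) - ρ i) := by
    rcases h₀ with h₀ | h₀ <;> rcases h₁ with h₁ | h₁ <;> simp_all
  have htwo : i + 1 + 1 = i := ρ.injective (by linear_combination hturn)
  rw [add_assoc, add_eq_left, Fin.ext_iff, Fin.val_add, Fin.val_one',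
    Nat.mod_eq_of_lt (a := 1) (by omega), Nat.mod_eq_of_lt (by omega), Fin.val_zero] at htwo
  omega

lemma apply_natCast_of_mem_circulantAut (hρ : ρ ∈ circulantAut N k) (hk : 1 ≤ k)
    (hN : 2 * k + 3 ≤ N) (m : ℕ) : ρ (m : Fin N) = ρ 0 + m * (ρ 1 - ρ 0) := by
  have hdiff (m : ℕ) : ρ ((m : Fin N) + 1) - ρ m = ρ 1 - ρ 0 := by
    induction m with
    | zero => simp
    | succ m ih => rw [Nat.cast_succ, sub_eq_sub_of_mem_circulantAut hρ hk hN, ih]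
  induction m with
  | zero => simp
  | succ m ih =>
    rw [Nat.cast_succ]
    linear_combination hdiff m + ih

lemma ncard_circulantAut_le (hk : 1 ≤ k) (hN : 2 * k + 3 ≤ N) :
    (circulantAut N k).ncard ≤ 2 * N := by
  have hinj : Set.InjOn (fun ρ : Equiv.Perm (Fin N) => (ρ 0, ρ 1 - ρ 0)) (circulantAut N k) := by
    intro ρ hρ ρ' hρ' h
    obtain ⟨h₀, h₁⟩ := Prod.mk.inj h
    ext1 i
    rw [← Fin.cast_val_eq_self i, apply_natCast_of_mem_circulantAut hρ hk hN,
      apply_natCast_of_mem_circulantAut hρ' hk hN, h₁, h₀]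
  have hmaps : ∀ ρ ∈ circulantAut N k, (ρ 0, ρ 1 - ρ 0) ∈ Set.univ ×ˢ ({1, -1} : Set (Fin N)) :=
    fun ρ hρ => ⟨Set.mem_univ _, sub_eq_one_or_neg_one_of_mem_circulantAut hρ hk hN (by simp)⟩
  calc (circulantAut N k).ncard
      ≤ (Set.univ ×ˢ ({1, -1} : Set (Fin N))).ncard := Set.ncard_le_ncard_of_injOn _ hmaps hinj
    _ = N * ({1, -1} : Set (Fin N)).ncard := by rw [Set.ncard_prod, Set.ncard_univ, Nat.card_fin]
    _ ≤ N * 2 := Nat.mul_le_mul_left _ ((Set.ncard_insert_le _ _).trans_eq (by simp))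
    _ = 2 * N := mul_comm _ _

end Dihedral

section Antipodal

variable {h : ℕ} [NeZero (2 * h)]

lemma not_near_iff_eq_ofNat (v : Fin (2 * h)) :
    ¬ Near (h - 1) v ↔ v = Fin.ofNat (2 * h) h := by
  have := NeZero.pos (2 * h)
  rw [Fin.ext_iff, Fin.val_ofNat, Nat.mod_eq_of_lt (by omega), Near]
  omega

lemma apply_add_of_mem_circulantAut {ρ : Equiv.Perm (Fin (2 * h))}
    (hρ : ρ ∈ circulantAut (2 * h) (h - 1)) (i : Fin (2 * h)) :
    ρ (i + Fin.ofNat (2 * h) h) = ρ i + Fin.ofNat (2 * h) h := by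
  have hanti := (hρ i (i + Fin.ofNat (2 * h) h)).not
  rw [not_near_iff_eq_ofNat, not_near_iff_eq_ofNat, add_sub_cancel_left,
    sub_eq_iff_eq_add'] at hanti
  exact hanti.2 rfl

lemma ncard_circulantAut_mul_factorial_le :
    (circulantAut (2 * h) (h - 1)).ncard * h ! ≤ (2 * h)! := by
  have hle : h ≤ 2 * h := by omega
  have hinj : Set.InjOn (fun ρ : Equiv.Perm (Fin (2 * h)) =>
      (Fin.castLEEmb hle).trans ρ.toEmbedding) (circulantAut (2 * h) (h - 1)) := by
    intro ρ hρ ρ' hρ' heq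
    have hlow (i : Fin (2 * h)) (hi : i.val < h) : ρ i = ρ' i := DFunLike.congr_fun heq ⟨i, hi⟩
    ext1 i
    by_cases hi : i.val < h
    · exact hlow i hi
    · have hh := NeZero.pos (2 * h)
      have hsub : (i - Fin.ofNat (2 * h) h).val < h := by
        rw [val_sub_eq_ite, Fin.val_ofNat, Nat.mod_eq_of_lt (by omega)]
        grind
      rw [← sub_add_cancel i (Fin.ofNat (2 * h) h), apply_add_of_mem_circulantAut hρ,
        apply_add_of_mem_circulantAut hρ', hlow _ hsub]
  calc (circulantAut (2 * h) (h - 1)).ncard * h !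
      ≤ (Set.univ : Set (Fin h ↪ Fin (2 * h))).ncard * h ! :=
        Nat.mul_le_mul_right _ (Set.ncard_le_ncard_of_injOn _ (fun _ _ => Set.mem_univ _) hinj)
    _ = h ! * (2 * h).descFactorial h := by
        rw [Set.ncard_univ, Nat.card_eq_fintype_card, Fintype.card_embedding_eq, Fintype.card_fin,
          Fintype.card_fin, mul_comm]
    _ = (2 * h)! := by
        rw [← Nat.factorial_mul_descFactorial hle, two_mul, Nat.add_sub_cancel]

end Antipodal

end Graph

section Precision

variable {N d : ℕ} {q : Coupling N}

lemma edgeSet_comm (π : Equiv.Perm (Fin N)) (a b : Fin N) :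
    (a, b) ∈ edgeSet d π ↔ (b, a) ∈ edgeSet d π := by
  simp only [edgeSet, Set.mem_ofPred_eq, Prod.mk.injEq, and_comm (a := a = _), or_comm]

open Classical in
lemma edgeMatrix_apply (π : Equiv.Perm (Fin N)) (a b : Fin N) :
    edgeMatrix d π a b = if (a, b) ∈ edgeSet d π then 1 else 0 := by
  simp [edgeMatrix, Set.indicator_apply]

lemma edgeMatrix_nonneg (π : Equiv.Perm (Fin N)) (a b : Fin N) : 0 ≤ edgeMatrix d π a b := by
  rw [edgeMatrix_apply]
  split_ifs <;> norm_num

lemma edgeMatrix_sq (π : Equiv.Perm (Fin N)) (a b : Fin N) :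
    edgeMatrix d π a b ^ 2 = edgeMatrix d π a b := by
  rw [edgeMatrix_apply]
  split_ifs <;> norm_num

lemma edgeMatrix_comm (π : Equiv.Perm (Fin N)) (a b : Fin N) :
    edgeMatrix d π a b = edgeMatrix d π b a := by
  rw [edgeMatrix_apply, edgeMatrix_apply, edgeSet_comm]

lemma edgeMatrix_self (hd : d / 2 < N) (π : Equiv.Perm (Fin N)) (a : Fin N) :
    edgeMatrix d π a a = 0 := by
  simp [edgeMatrix_apply, mem_edgeSet_iff_symm hd]

lemma sum_edgeMatrix (hd2 : Even d) (hd : d < N) (π : Equiv.Perm (Fin N)) (a : Fin N) :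
    ∑ b, edgeMatrix d π a b = d := by
  classical
  simp_rw [edgeMatrix_apply]
  rw [Finset.sum_boole, ← Set.ncard_coe_finset]
  simpa using ncard_neighbours hd2 hd π a

lemma precision_apply (π : Equiv.Perm (Fin N)) (q : Coupling N) (a b : Fin N) :
    precision d π q a b = (1 : Matrix (Fin N) (Fin N) ℝ) a b + edgeMatrix d π a b * q a b := rfl

lemma isHermitian_precision (π : Equiv.Perm (Fin N)) (hq : ∀ a b, q a b = q b a) :
    (precision d π q).IsHermitian :=
  Matrix.isHermitian_one.add <| Matrix.IsHermitian.ext fun a b => by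
    rw [star_trivial, Matrix.hadamard_apply, Matrix.hadamard_apply, edgeMatrix_comm,
      Matrix.of_apply, Matrix.of_apply, hq]

lemma mul_half_inv_le_half (x : ℝ) : x * (1 / (2 * x)) ≤ 1 / 2 := by
  calc x * (1 / (2 * x)) = x / x / 2 := by ring
    _ ≤ 1 / 2 := by gcongr; exact div_self_le_one x

lemma posSemidef_precision_sub_half (hd2 : Even d) (hd : d < N) (π : Equiv.Perm (Fin N))
    (hq : q ∈ couplingBox N d) : (precision d π q - (1 / 2 : ℝ) • 1).PosSemidef := by
  have hself := edgeMatrix_self (d := d) (by omega) π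
  refine posSemidef_of_sum_erase_abs_le
    ((isHermitian_precision π hq.1).sub (Matrix.isHermitian_one.smul (by simp))) fun a => ?_
  have hentry (b : Fin N) (hb : b ∈ Finset.univ.erase a) :
      |(precision d π q - (1 / 2 : ℝ) • 1) a b| ≤ edgeMatrix d π a b * (1 / (2 * d)) := by
    have hab := (Finset.ne_of_mem_erase hb).symm
    rw [Matrix.sub_apply, precision_apply, Matrix.smul_apply, Matrix.one_apply_ne hab, zero_add,
      smul_zero, sub_zero, abs_mul, abs_of_nonneg (edgeMatrix_nonneg π a b)]
    exact mul_le_mul_of_nonneg_left (abs_le.2 (hq.2 a b)) (edgeMatrix_nonneg π a b)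
  calc ∑ b ∈ Finset.univ.erase a, |(precision d π q - (1 / 2 : ℝ) • 1) a b|
      ≤ ∑ b ∈ Finset.univ.erase a, edgeMatrix d π a b * (1 / (2 * d)) :=
        Finset.sum_le_sum hentry
    _ = d * (1 / (2 * d)) := by
        rw [← Finset.sum_mul, Finset.sum_erase _ (hself a), sum_edgeMatrix hd2 hd]
    _ ≤ 1 / 2 := mul_half_inv_le_half _
    _ = (precision d π q - (1 / 2 : ℝ) • 1) a a := by
        rw [Matrix.sub_apply, precision_apply, hself, Matrix.smul_apply, Matrix.one_apply_eq]
        norm_num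

lemma posDef_precision (hd2 : Even d) (hd : d < N) (π : Equiv.Perm (Fin N))
    (hq : q ∈ couplingBox N d) : (precision d π q).PosDef :=
  posDef_of_posSemidef_sub_smul_one (by norm_num) (posSemidef_precision_sub_half hd2 hd π hq)

lemma abs_inv_precision_le (hd2 : Even d) (hd : d < N) (π : Equiv.Perm (Fin N))
    (hq : q ∈ couplingBox N d) (a b : Fin N) : |(precision d π q)⁻¹ a b| ≤ 2 := by
  simpa using abs_inv_apply_le (by norm_num) (posSemidef_precision_sub_half hd2 hd π hq) a b

lemma sum_sq_precision_sub_one_le (hd2 : Even d) (hd : d < N) (π : Equiv.Perm (Fin N))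
    (hq : q ∈ couplingBox N d) : ∑ a, ∑ b, (precision d π q - 1) a b ^ 2 ≤ N / (4 * d) := by
  calc ∑ a, ∑ b, (precision d π q - 1) a b ^ 2
      ≤ ∑ a, ∑ b, edgeMatrix d π a b * (1 / (2 * (d : ℝ))) ^ 2 := by
        refine Finset.sum_le_sum fun a _ => Finset.sum_le_sum fun b _ => ?_
        rw [Matrix.sub_apply, precision_apply, add_sub_cancel_left, mul_pow, edgeMatrix_sq]
        exact mul_le_mul_of_nonneg_left (sq_le_sq' (hq.2 a b).1 (hq.2 a b).2)
          (edgeMatrix_nonneg π a b)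
    _ = N / (4 * d) := by
        simp_rw [← Finset.sum_mul, sum_edgeMatrix hd2 hd]
        rw [Finset.sum_const, Finset.card_univ, Fintype.card_fin, nsmul_eq_mul]
        obtain rfl | hd0 := eq_or_ne d 0
        · simp
        · field_simp
          norm_num

lemma matSupport_precision_subset (π : Equiv.Perm (Fin N)) (q : Coupling N) :
    matSupport (precision d π q) ⊆ supportUnion d π := by
  classical
  rintro ⟨a, b⟩ hab
  contrapose! hab
  obtain ⟨hE, hne⟩ := not_or.1 hab
  simp [matSupport, precision_apply, edgeMatrix_apply, hE, Matrix.one_apply_ne hne]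

lemma matSupport_precision_eq (hd : d / 2 < N) (π : Equiv.Perm (Fin N))
    (hq : ∀ a b, a ≠ b → q a b ≠ 0) : matSupport (precision d π q) = supportUnion d π := by
  refine (matSupport_precision_subset π q).antisymm ?_
  rintro ⟨a, b⟩ hab
  rw [matSupport, Set.mem_ofPred_eq, precision_apply]
  obtain rfl | hne := eq_or_ne a b
  · simp [edgeMatrix_self hd]
  · rw [Matrix.one_apply_ne hne, edgeMatrix_apply, if_pos (hab.resolve_right hne), zero_add,
      one_mul]
    exact hq a b hne

open InformationTheory in
lemma klDiv_gaussianLaw_le (hd2 : Even d) (hd : d < N) (π : Equiv.Perm (Fin N))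
    (hq : q ∈ couplingBox N d) :
    klDiv (gaussianLaw d π q) (stdGaussian (EuclideanSpace ℝ (Fin N))) ≤
      ENNReal.ofReal (N / (4 * d)) := by
  refine (klDiv_multivariateGaussian_inv_le (by norm_num)
    (posSemidef_precision_sub_half hd2 hd π hq)).trans (ENNReal.ofReal_le_ofReal ?_)
  simpa using sum_sq_precision_sub_one_le hd2 hd π hq

lemma measurable_inv_precision_apply (π : Equiv.Perm (Fin N)) (a b : Fin N) :
    Measurable fun q : Coupling N => (precision d π q)⁻¹ a b := by
  have hprec : Measurable fun (q : Coupling N) (i j : Fin N) => precision d π q i j := by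
    simp only [precision_apply]
    fun_prop
  exact (measurable_inv_apply a b).comp hprec

lemma measurable_gaussianLaw (π : Equiv.Perm (Fin N)) :
    Measurable fun q : Coupling N => gaussianLaw d π q := by
  have hinv : Measurable fun (q : Coupling N) (a b : Fin N) => (precision d π q)⁻¹ a b :=
    measurable_pi_lambda _ fun a => measurable_pi_lambda _ (measurable_inv_precision_apply π a)
  exact measurable_multivariateGaussian_zero.comp hinv

end Precision

section Experiment

instance discreteMeasurableSpace_perm (N : ℕ) : DiscreteMeasurableSpace (Equiv.Perm (Fin N)) :=
  ⟨fun _ => MeasurableSpace.measurableSet_top⟩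

instance isProbabilityMeasure_gaussianLaw {N d : ℕ} (π : Equiv.Perm (Fin N)) (q : Coupling N) :
    IsProbabilityMeasure (gaussianLaw d π q) :=
  inferInstanceAs (IsProbabilityMeasure (multivariateGaussian _ _))

/-- The conditional law of the samples of an experiment given the permutation `τ`, as a Markov
kernel in the matrices `Q^(1), …, Q^(K)`. -/
noncomputable def dataKernel {N K : ℕ} (n d : ℕ) (τ : Equiv.Perm (Fin N)) :
    Kernel (Fin K → Coupling N) (Data N K n) where
  toFun q := Measure.pi fun k => Measure.pi fun _ => gaussianLaw d τ (q k)
  measurable' := measurable_measure_pi fun k => measurable_measure_pi fun _ =>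
    (measurable_gaussianLaw τ).comp (measurable_pi_apply k)

instance isMarkovKernel_dataKernel {N K n d : ℕ} (τ : Equiv.Perm (Fin N)) :
    IsMarkovKernel (dataKernel n d τ : Kernel (Fin K → Coupling N) _) :=
  ⟨fun q => inferInstanceAs (IsProbabilityMeasure
    (Measure.pi fun k => Measure.pi fun _ => gaussianLaw d τ (q k)))⟩

lemma measure_preimage_prodMk_le_of_indepFun {Ω α β : Type*} [MeasurableSpace Ω]
    [MeasurableSpace α] [MeasurableSpace β] {P : Measure Ω} [IsProbabilityMeasure P]
    {U : Ω → α} {Y : Ω → β} (hUY : IndepFun U Y P) (hU : Measurable U) (hY : Measurable Y)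
    {A : Set (α × β)} (hA : MeasurableSet A) {r : ℝ≥0∞}
    (hr : ∀ u, P {ω | (u, Y ω) ∈ A} ≤ r) : P {ω | (U ω, Y ω) ∈ A} ≤ r := by
  have := Measure.isProbabilityMeasure_map (μ := P) hU.aemeasurable
  calc P {ω | (U ω, Y ω) ∈ A} = P.map (fun ω => (U ω, Y ω)) A :=
        (Measure.map_apply (hU.prodMk hY) hA).symm
    _ = ∫⁻ u, P.map Y (Prod.mk u ⁻¹' A) ∂P.map U := by
        rw [hUY.map_prod_eq_prod_map_map hU.aemeasurable hY.aemeasurable, Measure.prod_apply hA]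
    _ ≤ ∫⁻ _, r ∂P.map U := lintegral_mono fun u =>
        (Measure.map_apply hY (measurable_prodMk_left hA)).trans_le (hr u)
    _ = r := by rw [lintegral_const, measure_univ, mul_one]

namespace IsExperiment

variable {Ω : Type*} [MeasurableSpace Ω] {N K n d : ℕ} {P : Measure Ω}
  {π : Ω → Equiv.Perm (Fin N)} {Q : Ω → Fin K → Coupling N} {X : Ω → Data N K n}

lemma measurableSet_perm (h : IsExperiment d P π Q X) (τ : Equiv.Perm (Fin N)) :
    MeasurableSet {ω | π ω = τ} :=
  h.measurable_perm (.singleton τ)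

lemma measure_perm_ne_zero (h : IsExperiment d P π Q X) (τ : Equiv.Perm (Fin N)) :
    P {ω | π ω = τ} ≠ 0 := by
  rw [h.uniform]
  exact ENNReal.inv_ne_zero.2 (ENNReal.natCast_ne_top _)

lemma cond_inter_preimage (h : IsExperiment d P π Q X) (τ : Equiv.Perm (Fin N))
    {B : Set (Fin K → Coupling N)} {C : Set (Data N K n)} (hB : MeasurableSet B)
    (hC : MeasurableSet C) :
    cond P {ω | π ω = τ} (Q ⁻¹' B ∩ X ⁻¹' C) =
      ∫⁻ ω in Q ⁻¹' B, dataKernel n d τ (Q ω) C ∂cond P {ω | π ω = τ} := by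
  rw [cond_apply (h.measurableSet_perm τ), ← Set.inter_assoc, h.samples τ B C hB hC,
    ProbabilityTheory.cond, Measure.restrict_smul, lintegral_smul_measure,
    Measure.restrict_restrict (h.measurable_coupling hB), Set.inter_comm, smul_eq_mul]
  rfl

variable [IsProbabilityMeasure P]

lemma isProbabilityMeasure_cond (h : IsExperiment d P π Q X) (τ : Equiv.Perm (Fin N)) :
    IsProbabilityMeasure (cond P {ω | π ω = τ}) :=
  cond_isProbabilityMeasure (h.measure_perm_ne_zero τ)

lemma identDistrib_cond (h : IsExperiment d P π Q X) (τ : Equiv.Perm (Fin N)) :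
    IdentDistrib Q Q (cond P {ω | π ω = τ}) P where
  aemeasurable_fst := h.measurable_coupling.aemeasurable
  aemeasurable_snd := h.measurable_coupling.aemeasurable
  map_eq := by
    ext B hB
    have hindep : P ({ω | π ω = τ} ∩ Q ⁻¹' B) = P {ω | π ω = τ} * P (Q ⁻¹' B) :=
      h.indep.measure_inter_preimage_eq_mul {τ} B (.singleton τ) hB
    rw [Measure.map_apply h.measurable_coupling hB, Measure.map_apply h.measurable_coupling hB,
      cond_apply (h.measurableSet_perm τ), hindep,
      ENNReal.inv_mul_cancel_left (h.measure_perm_ne_zero τ) (measure_ne_top _ _)]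

lemma identDistrib_cond_eval (h : IsExperiment d P π Q X) (τ : Equiv.Perm (Fin N)) (k : Fin K) :
    IdentDistrib (fun ω => Q ω k) (fun ω => Q ω k) (cond P {ω | π ω = τ}) P :=
  (h.identDistrib_cond τ).comp (measurable_pi_apply k)

lemma iIndepFun_cond (h : IsExperiment d P π Q X) (hQ : iIndepFun (fun k ω => Q ω k) P)
    (τ : Equiv.Perm (Fin N)) : iIndepFun (fun k ω => Q ω k) (cond P {ω | π ω = τ}) := by
  have := h.isProbabilityMeasure_cond τ
  rw [iIndepFun_iff_map_fun_eq_pi_map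
    fun k => (h.identDistrib_cond_eval τ k).aemeasurable_snd] at hQ
  rw [iIndepFun_iff_map_fun_eq_pi_map fun k => (h.identDistrib_cond_eval τ k).aemeasurable_fst]
  simp_rw [(h.identDistrib_cond_eval τ _).map_eq]
  exact (h.identDistrib_cond τ).map_eq.trans hQ

lemma map_cond_prodMk (h : IsExperiment d P π Q X) (τ : Equiv.Perm (Fin N)) :
    (cond P {ω | π ω = τ}).map (fun ω => (Q ω, X ω)) = P.map Q ⊗ₘ dataKernel n d τ := by
  have hQX := h.measurable_coupling.prodMk h.measurable_data
  have := h.isProbabilityMeasure_cond τ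
  have := Measure.isProbabilityMeasure_map (μ := P) h.measurable_coupling.aemeasurable
  have := Measure.isProbabilityMeasure_map (μ := cond P {ω | π ω = τ}) hQX.aemeasurable
  refine Measure.ext_prod fun {B C} hB hC => ?_
  rw [Measure.map_apply hQX (hB.prod hC), Measure.compProd_apply_prod hB hC,
    ← (h.identDistrib_cond τ).map_eq,
    setLIntegral_map hB ((dataKernel n d τ).measurable_coe hC) h.measurable_coupling]
  exact h.cond_inter_preimage τ hB hC

lemma cond_prodMk_mem (h : IsExperiment d P π Q X) (τ : Equiv.Perm (Fin N))
    {A : Set ((Fin K → Coupling N) × Data N K n)} (hA : MeasurableSet A) :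
    cond P {ω | π ω = τ} {ω | (Q ω, X ω) ∈ A} =
      ∫⁻ ω, dataKernel n d τ (Q ω) {x | (Q ω, x) ∈ A} ∂P := by
  have := Measure.isProbabilityMeasure_map (μ := P) h.measurable_coupling.aemeasurable
  calc cond P {ω | π ω = τ} {ω | (Q ω, X ω) ∈ A}
      = (P.map Q ⊗ₘ dataKernel n d τ) A := by
        rw [← h.map_cond_prodMk τ,
          Measure.map_apply (h.measurable_coupling.prodMk h.measurable_data) hA]
        rfl
    _ = ∫⁻ ω, dataKernel n d τ (Q ω) {x | (Q ω, x) ∈ A} ∂P := by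
        rw [Measure.compProd_apply hA, lintegral_map (Kernel.measurable_kernel_prodMk_left hA)
          h.measurable_coupling]
        rfl

lemma measure_prodMk_mem_le (h : IsExperiment d P π Q X)
    {A : Equiv.Perm (Fin N) → Set ((Fin K → Coupling N) × Data N K n)}
    (hA : ∀ τ, MeasurableSet (A τ)) {r : ℝ≥0∞}
    (hr : ∀ q : Fin K → Coupling N, (∀ k, q k ∈ couplingBox N d) →
      ∑ τ, dataKernel n d τ q {x | (q, x) ∈ A τ} ≤ (N ! : ℕ) * r) :
    P {ω | (Q ω, X ω) ∈ A (π ω)} ≤ r := by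
  have hfiber (τ : Equiv.Perm (Fin N)) : cond P {ω | π ω = τ} {ω | (Q ω, X ω) ∈ A (π ω)} =
      ∫⁻ ω, dataKernel n d τ (Q ω) {x | (Q ω, x) ∈ A τ} ∂P := by
    rw [← h.cond_prodMk_mem τ (hA τ)]
    refine measure_congr ?_
    filter_upwards [ae_cond_mem (h.measurableSet_perm τ)] with ω hω
    exact congrArg (fun τ' => (Q ω, X ω) ∈ A τ') hω
  have hmeas (τ : Equiv.Perm (Fin N)) :
      Measurable fun ω => dataKernel n d τ (Q ω) {x | (Q ω, x) ∈ A τ} :=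
    (Kernel.measurable_kernel_prodMk_left (hA τ)).comp h.measurable_coupling
  calc P {ω | (Q ω, X ω) ∈ A (π ω)}
      = ∑ τ, P {ω | π ω = τ} * cond P {ω | π ω = τ} {ω | (Q ω, X ω) ∈ A (π ω)} := by
        conv_lhs => rw [← sum_meas_smul_cond_fiber h.measurable_perm P]
        rw [Measure.coe_finsetSum, Finset.sum_apply]
        rfl
    _ = ((N ! : ℕ) : ℝ≥0∞)⁻¹ *
          ∫⁻ ω, ∑ τ, dataKernel n d τ (Q ω) {x | (Q ω, x) ∈ A τ} ∂P := by
        simp_rw [h.uniform, hfiber]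
        rw [← Finset.mul_sum, lintegral_finsetSum _ fun τ _ => hmeas τ]
    _ ≤ ((N ! : ℕ) : ℝ≥0∞)⁻¹ * ∫⁻ _, (N ! : ℕ) * r ∂P := by
        refine mul_le_mul_right (lintegral_mono_ae ?_) _
        filter_upwards [h.mem_box] with ω hω using hr (Q ω) hω
    _ = r := by
        rw [lintegral_const, measure_univ, mul_one, ENNReal.inv_mul_cancel_left
          (Nat.cast_ne_zero.2 N.factorial_ne_zero) (ENNReal.natCast_ne_top _)]

end IsExperiment

end Experiment

section Family

variable {N d : ℕ}

/-- The deviation `H ⊙ (Q - Q₀)` of the precision matrix `I + H ⊙ Q` from the common one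
`I + H ⊙ Q₀`, as an array. -/
noncomputable def deviation (d : ℕ) (τ : Equiv.Perm (Fin N)) (q₀ q : Coupling N) : Coupling N :=
  fun a b => (edgeMatrix d τ ⊙ Matrix.of (q - q₀)) a b

lemma measurable_deviation (τ : Equiv.Perm (Fin N)) (q₀ : Coupling N) :
    Measurable (deviation d τ q₀) := by
  refine measurable_pi_lambda _ fun a => measurable_pi_lambda _ fun b => ?_
  simp only [deviation, Matrix.hadamard_apply, Matrix.of_apply, Pi.sub_apply]
  fun_prop

lemma precision_add_deviation (τ : Equiv.Perm (Fin N)) (q₀ q : Coupling N) :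
    precision d τ q₀ + Matrix.of (deviation d τ q₀ q) = precision d τ q := by
  ext a b
  simp only [deviation, precision_apply, Matrix.add_apply, Matrix.of_apply,
    Matrix.hadamard_apply, Pi.sub_apply]
  ring

lemma matSupport_deviation_subset (τ : Equiv.Perm (Fin N)) (q₀ q : Coupling N) :
    matSupport (Matrix.of (deviation d τ q₀ q)) ⊆ supportUnion d τ := by
  classical
  rintro ⟨a, b⟩ hab
  refine Or.inl ?_
  contrapose! hab
  simp [matSupport, deviation, Matrix.hadamard_apply, edgeMatrix_apply, hab]

namespace IsExperiment

variable {Ω : Type*} [MeasurableSpace Ω] {K n : ℕ} {P : Measure Ω}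
  {π : Ω → Equiv.Perm (Fin N)} {Q : Ω → Fin K → Coupling N} {X : Ω → Data N K n}

lemma cond_deviation_inter_preimage (h : IsExperiment d P π Q X) (τ : Equiv.Perm (Fin N))
    (q₀ : Coupling N) {B : Set (Fin K → Coupling N)} {C : Set (Data N K n)}
    (hB : MeasurableSet B) (hC : MeasurableSet C) :
    cond P {ω | π ω = τ} ((fun ω k => deviation d τ q₀ (Q ω k)) ⁻¹' B ∩ X ⁻¹' C) =
      ∫⁻ ω in (fun ω k => deviation d τ q₀ (Q ω k)) ⁻¹' B,
        Measure.pi (fun k => Measure.pi fun _ : Fin n => multivariateGaussian 0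
          (precision d τ q₀ + Matrix.of (deviation d τ q₀ (Q ω k)))⁻¹) C
        ∂cond P {ω | π ω = τ} := by
  have hdev : Measurable fun (q : Fin K → Coupling N) k => deviation d τ q₀ (q k) :=
    measurable_pi_lambda _ fun k => (measurable_deviation τ q₀).comp (measurable_pi_apply k)
  simp_rw [precision_add_deviation]
  exact h.cond_inter_preimage τ (hdev hB) hC

variable [IsProbabilityMeasure P]

lemma isRandomSubGaussianFamily (h : IsExperiment d P π Q X) (hd2 : Even d) (hd : d < N)
    {q₀ : Coupling N} (hq₀ : q₀ ∈ couplingBox N d) (hne : ∀ a b, a ≠ b → q₀ a b ≠ 0)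
    (hindep : iIndepFun (fun k ω => Q ω k) P)
    (hid : ∀ k l, IdentDistrib (fun ω => Q ω k) (fun ω => Q ω l) P P)
    (τ : Equiv.Perm (Fin N)) {c : ℝ} (hc : 0 < c)
    (hspec : ∀ r ∈ spectrum ℝ (precision d τ q₀), c ≤ r / 2)
    (hnorm : ∀ᵐ ω ∂P, ∀ k,
      ‖Matrix.toEuclideanCLM (𝕜 := ℝ) (Matrix.of (deviation d τ q₀ (Q ω k)))‖ ≤ c)
    {σ : ℝ≥0} (hσ : 1 ≤ σ) :
    IsRandomSubGaussianFamily (cond P {ω | π ω = τ}) (precision d τ q₀)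
      (fun ω k => deviation d τ q₀ (Q ω k)) X σ := by
  have := h.isProbabilityMeasure_cond τ
  have hQ (k : Fin K) : Measurable fun ω => Q ω k :=
    (measurable_pi_apply k).comp h.measurable_coupling
  have hac : cond P {ω | π ω = τ} ≪ P := cond_absolutelyContinuous
  have hbox := hac.ae_le h.mem_box
  have hdev := measurable_deviation (d := d) τ q₀
  exact {
    posDef := posDef_precision hd2 hd τ hq₀
    measurable_dev := measurable_pi_lambda _ fun k => hdev.comp (hQ k)
    measurable_data := h.measurable_data
    indep := (h.iIndepFun_cond hindep τ).comp _ fun _ => hdev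
    identDistrib := fun k l => ((h.identDistrib_cond_eval τ k).trans
      ((hid k l).trans (h.identDistrib_cond_eval τ l).symm)).comp hdev
    bounds := by
      refine ⟨2, c, two_pos, hc, hspec, ?_⟩
      filter_upwards [hbox, hac.ae_le hnorm] with ω hω hωc k
      rw [precision_add_deviation, matSupport_precision_eq (by omega) τ hne]
      exact ⟨posDef_precision hd2 hd τ (hω k), matSupport_deviation_subset τ q₀ (Q ω k),
        abs_inv_precision_le hd2 hd τ (hω k), hωc k⟩
    integrable_inv := fun k i j => by
      simp_rw [precision_add_deviation]
      refine Integrable.of_bound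
        ((measurable_inv_precision_apply τ i j).comp (hQ k)).aestronglyMeasurable 2 ?_
      filter_upwards [hbox] with ω hω using abs_inv_precision_le hd2 hd τ (hω k) i j
    samples := by
      refine ⟨fun _ A => multivariateGaussian 0 A⁻¹, ?_, fun B C hB hC =>
        h.cond_deviation_inter_preimage τ q₀ hB hC⟩
      filter_upwards [hbox] with ω hω k
      rw [precision_add_deviation]
      exact isSubGaussianVector_multivariateGaussian (posDef_precision hd2 hd τ (hω k)) hσ }

end IsExperiment

end Family

section Numerics

lemma log_six_le_two : Real.log 6 ≤ 2 := by
  rw [Real.log_le_iff_le_exp (by norm_num), show (2 : ℝ) = 1 + 1 by norm_num, Real.exp_add]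
  nlinarith [Real.exp_one_gt_d9]

lemma mul_sub_one_mul_sub_two_le_factorial (h : ℕ) :
    (h * (h - 1) * (h - 2) : ℝ) ≤ h ! := by
  match h with
  | 0 | 1 | 2 => simp
  | m + 3 =>
    calc ((m + 3 : ℕ) * ((m + 3 : ℕ) - 1) * ((m + 3 : ℕ) - 2) : ℝ)
        = (m + 3) * (m + 2) * (m + 1) * 1 := by push_cast; ring
      _ ≤ (m + 3) * (m + 2) * (m + 1) * m ! := by
        gcongr
        exact_mod_cast m.factorial_pos
      _ = (m + 3) ! := by
        simp only [Nat.factorial_succ]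
        push_cast
        ring

lemma three_halves_le_log_five : 3 / 2 ≤ Real.log 5 := by
  have hexp : Real.exp 3 ≤ 5 ^ 2 := by
    calc Real.exp 3 = Real.exp 1 ^ 3 := by rw [← Real.exp_nat_mul]; norm_num
      _ ≤ 2.7182818286 ^ 3 := by gcongr; exact Real.exp_one_lt_d9.le
      _ ≤ 5 ^ 2 := by norm_num
  rw [← Real.le_log_iff_exp_le (by norm_num), Real.log_pow] at hexp
  push_cast at hexp
  linarith

lemma mul_log_sub_pos {N : ℕ} (hN : 5 ≤ N) :
    0 < (N : ℝ) * Real.log N - N - Real.log (2 * N) := by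
  have hN' : (5 : ℝ) ≤ N := by exact_mod_cast hN
  have hlog : 3 / 2 ≤ Real.log N :=
    three_halves_le_log_five.trans (Real.log_le_log (by norm_num) hN')
  rw [Real.log_mul two_ne_zero (by positivity)]
  nlinarith [Real.log_two_lt_d9]

lemma mul_log_sub_lt_log_factorial_div {N : ℕ} (hN : N ≠ 0) :
    (N : ℝ) * Real.log N - N - Real.log (2 * N) < Real.log (N ! / (2 * N)) := by
  have hN1 : (1 : ℝ) ≤ N := by exact_mod_cast Nat.one_le_iff_ne_zero.2 hN
  have hlog : 0 ≤ Real.log N := Real.log_nonneg hN1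
  have hlogpi : 0 < Real.log (2 * Real.pi) := Real.log_pos (by linarith [Real.pi_gt_three])
  rw [Real.log_div (Nat.cast_ne_zero.2 N.factorial_ne_zero) (by positivity)]
  linarith [Stirling.le_log_factorial_stirling hN]

lemma two_mul_log_sub_one_le_log_factorial {h : ℕ} (hh : 3 ≤ h) :
    2 * (Real.log (2 * h) - 1) ≤ Real.log (h ! : ℝ) := by
  have hh' : (3 : ℝ) ≤ h := by exact_mod_cast hh
  have hfac : (2 * h : ℝ) ^ 2 ≤ 6 * h ! := by
    nlinarith [mul_sub_one_mul_sub_two_le_factorial h, mul_self_nonneg ((h : ℝ) - 3)]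
  calc 2 * (Real.log (2 * h) - 1) = Real.log ((2 * h) ^ 2) - 2 := by
        rw [Real.log_pow]
        push_cast
        ring
    _ ≤ Real.log (6 * h !) - 2 := by gcongr
    _ = Real.log 6 + Real.log h ! - 2 := by
        rw [Real.log_mul (by norm_num) (Nat.cast_ne_zero.2 h.factorial_ne_zero)]
    _ ≤ Real.log h ! := by linarith [log_six_le_two]

lemma mul_log_sub_lt_log_two_mul_factorial {h : ℕ} (hh : 3 ≤ h) :
    (2 * h : ℝ) * Real.log (2 * h) - 2 * h - Real.log (2 * (2 * h)) < Real.log 2 * h ! := by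
  have hh' : (3 : ℝ) ≤ h := by exact_mod_cast hh
  have hlog : Real.log (2 * h) ≤ 1 + h / 3 := by
    have hsplit : Real.log (2 * h) = Real.log 6 + Real.log (h / 3) := by
      rw [← Real.log_mul (by norm_num) (by positivity)]
      ring_nf
    linarith [log_six_le_two, Real.log_le_sub_one_of_pos (by positivity : (0 : ℝ) < h / 3)]
  have hlog4 : 3 * Real.log 2 ≤ Real.log (2 * (2 * h)) := by
    rw [← Real.log_rpow two_pos]
    exact Real.log_le_log (by positivity) (by norm_num; linarith)
  have hlog2 := Real.log_two_gt_d9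
  calc (2 * h : ℝ) * Real.log (2 * h) - 2 * h - Real.log (2 * (2 * h))
      ≤ 2 * h * (1 + h / 3) - 2 * h - 3 * 0.693 := by
        gcongr
        linarith
    _ < 0.693 * (h * (h - 1) * (h - 2)) := by
        nlinarith [mul_nonneg (sub_nonneg.2 hh') (mul_self_nonneg ((h : ℝ) - 3))]
    _ ≤ 0.693 * h ! := by
        gcongr
        exact mul_sub_one_mul_sub_two_le_factorial h
    _ ≤ Real.log 2 * h ! := by
        gcongr
        linarith

lemma quarter_log_le {N : ℕ} (hN : 16 ≤ N) :
    1 / 4 * Real.log N ≤ Real.log N - 1 - Real.log (8 * N) / N := by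
  have hN' : (16 : ℝ) ≤ N := by exact_mod_cast hN
  have hlog2 := Real.log_two_gt_d9
  have hlog : 4 * Real.log 2 ≤ Real.log N := by
    calc 4 * Real.log 2 = Real.log (2 ^ 4) := by rw [Real.log_pow, Nat.cast_ofNat]
      _ ≤ Real.log N := Real.log_le_log (by norm_num) (by linarith)
  have hlog8 : Real.log (8 * N) / N ≤ (3 * Real.log 2 + Real.log N) / 16 := by
    calc Real.log (8 * N) / N = (Real.log (2 ^ 3) + Real.log N) / N := by
          rw [Real.log_mul (by norm_num) (by positivity)]
          norm_num
      _ = (3 * Real.log 2 + Real.log N) / N := by rw [Real.log_pow, Nat.cast_ofNat]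
      _ ≤ (3 * Real.log 2 + Real.log N) / 16 := by gcongr
  linarith

end Numerics

section Bound

/-- The reference law of Fano's inequality: all the samples are independent and standard
Gaussian. -/
noncomputable def stdData (N K n : ℕ) : Measure (Data N K n) :=
  Measure.pi fun _ => Measure.pi fun _ => stdGaussian (EuclideanSpace ℝ (Fin N))

instance isProbabilityMeasure_stdData (N K n : ℕ) : IsProbabilityMeasure (stdData N K n) :=
  inferInstanceAs (IsProbabilityMeasure
    (Measure.pi fun _ => Measure.pi fun _ => stdGaussian (EuclideanSpace ℝ (Fin N))))

lemma factorial_div_mul_ncard_supportUnion_le {N d : ℕ} (hd2 : Even d) (hd0 : 0 < d)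
    (hd : d + 3 ≤ N) (S : Set (Fin N × Fin N)) :
    (N ! / (2 * N) : ℝ) * {τ : Equiv.Perm (Fin N) | supportUnion d τ = S}.ncard ≤ N ! := by
  have : NeZero N := ⟨by omega⟩
  have hN : (0 : ℝ) < N := Nat.cast_pos.2 (by omega)
  obtain ⟨k, rfl⟩ := even_iff_exists_two_mul.1 hd2
  have hcard : {τ : Equiv.Perm (Fin N) | supportUnion (2 * k) τ = S}.ncard ≤ 2 * N :=
    (ncard_supportUnion_eq_le (by omega) S).trans (ncard_circulantAut_le (by omega) (by omega))
  rw [div_mul_eq_mul_div, div_le_iff₀ (by positivity)]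
  gcongr
  exact_mod_cast hcard

lemma factorial_mul_ncard_supportUnion_le (h : ℕ) [NeZero (2 * h)]
    (S : Set (Fin (2 * h) × Fin (2 * h))) :
    (h ! : ℝ) * {τ : Equiv.Perm (Fin (2 * h)) | supportUnion (2 * (h - 1)) τ = S}.ncard ≤
      (2 * h)! := by
  have hh : 2 * h ≠ 0 := NeZero.ne _
  have hcard := ncard_supportUnion_eq_le (d := 2 * (h - 1)) (by omega) S
  rw [Nat.mul_div_cancel_left _ two_pos] at hcard
  rw [mul_comm]
  exact_mod_cast (Nat.mul_le_mul_right _ hcard).trans ncard_circulantAut_mul_factorial_le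

open InformationTheory in
lemma klDiv_dataKernel_le {N K n d : ℕ} (hd2 : Even d) (hd : d < N) (τ : Equiv.Perm (Fin N))
    {q : Fin K → Coupling N} (hq : ∀ k, q k ∈ couplingBox N d) :
    klDiv (dataKernel n d τ q) (stdData N K n) ≤ ENNReal.ofReal (n * K * (N / (4 * d))) := by
  calc klDiv (dataKernel n d τ q) (stdData N K n)
      = ∑ k, ∑ _ : Fin n, klDiv (gaussianLaw d τ (q k)) (stdGaussian _) :=
        (klDiv_pi _ _).trans (Finset.sum_congr rfl fun k _ => klDiv_pi _ _)
    _ ≤ ∑ _ : Fin K, ∑ _ : Fin n, ENNReal.ofReal (N / (4 * d)) := by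
        gcongr with k _ _ _
        exact klDiv_gaussianLaw_le hd2 hd τ (hq k)
    _ = ENNReal.ofReal (n * K * (N / (4 * d))) := by
        simp only [Finset.sum_const, Finset.card_univ, Fintype.card_fin, nsmul_eq_mul]
        rw [ENNReal.ofReal_mul (by positivity), ENNReal.ofReal_mul (by positivity),
          ENNReal.ofReal_natCast, ENNReal.ofReal_natCast]
        ring

namespace IsEstimate

variable {Ω 𝓤 : Type*} [MeasurableSpace Ω] [MeasurableSpace 𝓤] {N K n d : ℕ} {P : Measure Ω}
  [IsProbabilityMeasure P] {π : Ω → Equiv.Perm (Fin N)} {Q : Ω → Fin K → Coupling N}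
  {X : Ω → Data N K n} {U : Ω → 𝓤} {S' : Ω → Set (Fin N × Fin N)}

lemma measure_success_le (hS : IsEstimate P π Q X U S') (h : IsExperiment d P π Q X) {r : ℝ≥0∞}
    (hr : ∀ q : Fin K → Coupling N, (∀ k, q k ∈ couplingBox N d) →
      ∀ s : Data N K n → Set (Fin N × Fin N), Measurable s →
        ∑ τ, dataKernel n d τ q {x | s x = supportUnion d τ} ≤ (N ! : ℕ) * r) :
    P {ω | S' ω = supportUnion d (π ω)} ≤ r := by
  obtain ⟨s, hs, hS's⟩ := hS.factors
  have hA : MeasurableSet {p : 𝓤 × Equiv.Perm (Fin N) × (Fin K → Coupling N) × Data N K n |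
      s (p.2.2.2, p.2.2.1, p.1) = supportUnion d p.2.1} :=
    measurableSet_eq_fun (hs.comp (by fun_prop))
      ((Measurable.of_discrete (f := supportUnion d)).comp (measurable_fst.comp measurable_snd))
  simp_rw [hS's]
  refine measure_preimage_prodMk_le_of_indepFun hS.indep hS.measurable_rand
    (h.measurable_perm.prodMk (h.measurable_coupling.prodMk h.measurable_data)) hA fun u => ?_
  have hAu (τ : Equiv.Perm (Fin N)) : MeasurableSet
      {p : (Fin K → Coupling N) × Data N K n | s (p.2, p.1, u) = supportUnion d τ} :=
    measurableSet_eq_fun (hs.comp (by fun_prop)) measurable_const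
  exact h.measure_prodMk_mem_le hAu fun q hq => hr q hq (fun x => s (x, q, u))
    (hs.comp (by fun_prop))

lemma measureReal_success_le (hS : IsEstimate P π Q X U S') (h : IsExperiment d P π Q X) {r : ℝ}
    (hr0 : 0 ≤ r) (hr : ∀ q : Fin K → Coupling N, (∀ k, q k ∈ couplingBox N d) →
      ∀ s : Data N K n → Set (Fin N × Fin N), Measurable s →
        ∑ τ, (dataKernel n d τ q).real {x | s x = supportUnion d τ} ≤ N ! * r) :
    P.real {ω | S' ω = supportUnion d (π ω)} ≤ r := by
  refine ENNReal.toReal_le_of_le_ofReal hr0 (hS.measure_success_le h fun q hq s hs => ?_)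
  calc ∑ τ, dataKernel n d τ q {x | s x = supportUnion d τ}
      = ENNReal.ofReal (∑ τ, (dataKernel n d τ q).real {x | s x = supportUnion d τ}) := by
        rw [ENNReal.ofReal_sum_of_nonneg fun _ _ => measureReal_nonneg]
        exact Finset.sum_congr rfl fun τ _ => (ofReal_measureReal (measure_ne_top _ _)).symm
    _ ≤ ENNReal.ofReal (N ! * r) := ENNReal.ofReal_le_ofReal (hr q hq s hs)
    _ = (N ! : ℕ) * ENNReal.ofReal r := by
        rw [ENNReal.ofReal_mul (by positivity), ENNReal.ofReal_natCast]

lemma log_mul_success_le (hS : IsEstimate P π Q X U S') (h : IsExperiment d P π Q X)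
    (hd2 : Even d) (hd : d < N) {M : ℝ} (hM : 1 < M)
    (hfiber : ∀ S : Set (Fin N × Fin N),
      M * {τ : Equiv.Perm (Fin N) | supportUnion d τ = S}.ncard ≤ (N ! : ℝ)) :
    Real.log M * P.real {ω | S' ω = supportUnion d (π ω)} ≤
      n * K * (N / (4 * d)) + Real.log 2 := by
  have hlogM := Real.log_pos hM
  rw [mul_comm, ← le_div_iff₀ hlogM]
  refine hS.measureReal_success_le h (by positivity) fun q hq s hs => ?_
  have hcard : (Fintype.card (Equiv.Perm (Fin N)) : ℝ) = N ! := by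
    rw [Fintype.card_perm, Fintype.card_fin]
  have hfano := log_mul_sum_measureReal_le (by positivity)
    (fun τ => klDiv_dataKernel_le (n := n) hd2 hd τ hq) hM.le
    (A := fun τ => {x | s x = supportUnion d τ}) (fun τ => hs (measurableSet_singleton _))
    (hcard ▸ mul_sum_measureReal_eq_le (stdData N K n) hs _ hfiber)
  rwa [mul_div_assoc', le_div_iff₀' hlogM, ← hcard]

lemma mul_success_le_one (hS : IsEstimate P π Q X U S') (h : IsExperiment d P π Q X)
    (hd2 : Even d) (hd : d < N) (hnK : n * K = 0) {M : ℝ} (hM : 0 < M)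
    (hfiber : ∀ S : Set (Fin N × Fin N),
      M * {τ : Equiv.Perm (Fin N) | supportUnion d τ = S}.ncard ≤ (N ! : ℝ)) :
    M * P.real {ω | S' ω = supportUnion d (π ω)} ≤ 1 := by
  rw [mul_comm, ← le_div_iff₀ hM]
  refine hS.measureReal_success_le h (by positivity) fun q hq s hs => ?_
  have hlaw (τ : Equiv.Perm (Fin N)) : dataKernel n d τ q = stdData N K n := by
    have hkl := klDiv_dataKernel_le (n := n) hd2 hd τ hq
    rw [← Nat.cast_mul, hnK, Nat.cast_zero, zero_mul, ENNReal.ofReal_zero,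
      nonpos_iff_eq_zero] at hkl
    exact InformationTheory.klDiv_eq_zero_iff.1 hkl
  simp_rw [hlaw]
  rw [mul_one_div, le_div_iff₀' hM]
  exact mul_sum_measureReal_eq_le (stdData N K n) hs _ hfiber

lemma success_mul_lt_of_add_three_le (hS : IsEstimate P π Q X U S') (h : IsExperiment d P π Q X)
    (hN : 5 ≤ N) (hd2 : Even d) (hd0 : 0 < d) (hd : d + 3 ≤ N) :
    P.real {ω | S' ω = supportUnion d (π ω)} * (N * Real.log N - N - Real.log (2 * N)) <
      n * N * K + Real.log 2 := by
  have hN0 : (0 : ℝ) < N := Nat.cast_pos.2 (by omega)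
  have hD := mul_log_sub_pos hN
  have hlog := mul_log_sub_lt_log_factorial_div (N := N) (by omega)
  have hM : (1 : ℝ) < N ! / (2 * N) :=
    (Real.log_pos_iff (by positivity)).1 (hD.trans hlog)
  have hfano := hS.log_mul_success_le h hd2 (by omega) hM
    (factorial_div_mul_ncard_supportUnion_le hd2 hd0 hd)
  have hdeg : (N : ℝ) / (4 * d) ≤ N :=
    div_le_self hN0.le (by exact_mod_cast (by omega : 1 ≤ 4 * d))
  obtain hp | hp := (measureReal_nonneg (μ := P)
    (s := {ω | S' ω = supportUnion d (π ω)})).eq_or_lt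
  · rw [← hp, zero_mul]
    positivity
  calc P.real {ω | S' ω = supportUnion d (π ω)} * (N * Real.log N - N - Real.log (2 * N))
      < P.real {ω | S' ω = supportUnion d (π ω)} * Real.log (N ! / (2 * N)) := by gcongr
    _ ≤ n * K * (N / (4 * d)) + Real.log 2 := mul_comm (Real.log _) _ ▸ hfano
    _ ≤ n * K * N + Real.log 2 := by gcongr
    _ = n * N * K + Real.log 2 := by ring

lemma success_mul_lt_of_add_two_eq_of_mul_eq_zero (hS : IsEstimate P π Q X U S')
    (hexp : IsExperiment d P π Q X) {h : ℕ} (hh : 3 ≤ h) (hN : N = 2 * h)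
    (hd : d = 2 * (h - 1)) (hnK : n * K = 0) :
    P.real {ω | S' ω = supportUnion d (π ω)} * (N * Real.log N - N - Real.log (2 * N)) <
      Real.log 2 := by
  subst hN hd
  have : NeZero (2 * h) := ⟨by omega⟩
  have hfac : (0 : ℝ) < h ! := by exact_mod_cast h.factorial_pos
  have hsucc := hS.mul_success_le_one hexp (even_two_mul _) (by omega) hnK hfac
    (factorial_mul_ncard_supportUnion_le h)
  have hD := mul_log_sub_pos (N := 2 * h) (by omega)
  push_cast at hD ⊢
  refine lt_of_mul_lt_mul_left ?_ hfac.le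
  rw [← mul_assoc]
  calc h ! * P.real {ω | S' ω = supportUnion (2 * (h - 1)) (π ω)} *
        (2 * h * Real.log (2 * h) - 2 * h - Real.log (2 * (2 * h)))
      ≤ 1 * (2 * h * Real.log (2 * h) - 2 * h - Real.log (2 * (2 * h))) := by gcongr
    _ < Real.log 2 * h ! := by
        rw [one_mul]
        exact mul_log_sub_lt_log_two_mul_factorial hh
    _ = h ! * Real.log 2 := mul_comm _ _

lemma success_mul_le_of_add_two_eq_of_mul_pos (hS : IsEstimate P π Q X U S')
    (hexp : IsExperiment d P π Q X) {h : ℕ} (hh : 3 ≤ h) (hN : N = 2 * h)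
    (hd : d = 2 * (h - 1)) (hnK : 0 < n * K) :
    P.real {ω | S' ω = supportUnion d (π ω)} * (N * Real.log N - N - Real.log (2 * N)) ≤
      n * N * K := by
  subst hN hd
  have : NeZero (2 * h) := ⟨by omega⟩
  have hh' : (3 : ℝ) ≤ h := by exact_mod_cast hh
  have hnK' : (1 : ℝ) ≤ n * K := by exact_mod_cast hnK
  have hfac : (1 : ℝ) < h ! := by exact_mod_cast Nat.one_lt_factorial.2 (by omega)
  have hfano := hS.log_mul_success_le hexp (even_two_mul _) (by omega) hfac
    (factorial_mul_ncard_supportUnion_le h)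
  have hdeg : ((2 * h : ℕ) : ℝ) / (4 * (2 * (h - 1) : ℕ)) ≤ 1 := by
    refine div_le_one_of_le₀ ?_ (by positivity)
    exact_mod_cast (by omega : 2 * h ≤ 4 * (2 * (h - 1)))
  set p := P.real {ω | S' ω = supportUnion (2 * (h - 1)) (π ω)}
  have hp : 0 ≤ p := measureReal_nonneg
  have hsucc : 2 * (Real.log (2 * h) - 1) * p ≤ 2 * (n * K) := by
    calc 2 * (Real.log (2 * h) - 1) * p ≤ Real.log h ! * p := by
          gcongr
          exact two_mul_log_sub_one_le_log_factorial hh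
      _ ≤ n * K * ((2 * h : ℕ) / (4 * (2 * (h - 1) : ℕ))) + Real.log 2 := hfano
      _ ≤ n * K * 1 + n * K := by
          gcongr
          linarith [Real.log_two_lt_d9]
      _ = 2 * (n * K) := by ring
  have hlog : 0 ≤ Real.log (2 * (2 * h)) := Real.log_nonneg (by linarith)
  push_cast
  calc p * (2 * h * Real.log (2 * h) - 2 * h - Real.log (2 * (2 * h)))
      ≤ p * (2 * h * Real.log (2 * h) - 2 * h) :=
        mul_le_mul_of_nonneg_left (sub_le_self _ hlog) hp
    _ = h * (2 * (Real.log (2 * h) - 1) * p) := by ring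
    _ ≤ h * (2 * (n * K)) := by gcongr
    _ = n * (2 * h) * K := by ring

lemma success_mul_lt (hS : IsEstimate P π Q X U S') (h : IsExperiment d P π Q X) (hN : 5 ≤ N)
    (hd2 : Even d) (hd0 : 0 < d) (hd : d + 2 ≤ N) :
    P.real {ω | S' ω = supportUnion d (π ω)} * (N * Real.log N - N - Real.log (2 * N)) <
      n * N * K + Real.log 2 := by
  obtain hd | hd := hd.eq_or_lt
  · obtain ⟨m, rfl⟩ := even_iff_exists_two_mul.1 hd2
    have hm : 3 ≤ m + 1 := by omega
    have hN' : N = 2 * (m + 1) := by omega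
    obtain hnK | hnK := Nat.eq_zero_or_pos (n * K)
    · exact (hS.success_mul_lt_of_add_two_eq_of_mul_eq_zero h hm hN' rfl hnK).trans_le
        (le_add_of_nonneg_left (by positivity))
    · exact (hS.success_mul_le_of_add_two_eq_of_mul_pos h hm hN' rfl hnK).trans_lt
        (lt_add_of_pos_right _ (Real.log_pos one_lt_two))
  · exact hS.success_mul_lt_of_add_three_le h hN hd2 hd0 hd

lemma one_sub_lt_failure (hS : IsEstimate P π Q X U S') (h : IsExperiment d P π Q X) (hN : 5 ≤ N)
    (hd2 : Even d) (hd0 : 0 < d) (hd : d + 2 ≤ N) :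
    1 - ((n : ℝ) * N * K + Real.log 2) / (N * Real.log N - N - Real.log (2 * N)) <
      P.real {ω | S' ω ≠ supportUnion d (π ω)} := by
  have hsucc := hS.success_mul_lt h hN hd2 hd0 hd
  rw [← lt_div_iff₀ (mul_log_sub_pos hN)] at hsucc
  have hcover : 1 ≤ P.real {ω | S' ω = supportUnion d (π ω)} +
      P.real {ω | S' ω ≠ supportUnion d (π ω)} := by
    calc 1 = P.real ({ω | S' ω = supportUnion d (π ω)} ∪ {ω | S' ω = supportUnion d (π ω)}ᶜ) := by
          rw [Set.union_compl_self, probReal_univ]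
      _ ≤ _ := measureReal_union_le _ _
  linarith

lemma half_lt_failure (hS : IsEstimate P π Q X U S') (h : IsExperiment d P π Q X) (hN : 5 ≤ N)
    (hd2 : Even d) (hd0 : 0 < d) (hd : d + 2 ≤ N) (hK : 0 < K)
    (hn : (n : ℝ) ≤ Real.log N / (2 * K) - 1 / (2 * K) - Real.log (8 * N) / (2 * N * K)) :
    1 / 2 < P.real {ω | S' ω ≠ supportUnion d (π ω)} := by
  have : (0 : ℝ) < N := Nat.cast_pos.2 (by omega)
  have : (0 : ℝ) < K := Nat.cast_pos.2 hK
  have hlog : Real.log (8 * N) = Real.log (2 * N) + 2 * Real.log 2 := by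
    rw [show (8 * N : ℝ) = 2 * N * 2 ^ 2 by ring, Real.log_mul (by positivity) (by norm_num),
      Real.log_pow, Nat.cast_ofNat]
  have hn' : n * N * K * 2 ≤ N * Real.log N - N - Real.log (8 * N) := by
    calc (n * N * K * 2 : ℝ) = n * (2 * N * K) := by ring
      _ ≤ (Real.log N / (2 * K) - 1 / (2 * K) - Real.log (8 * N) / (2 * N * K)) *
          (2 * N * K) := by gcongr
      _ = N * Real.log N - N - Real.log (8 * N) := by field_simp
  have hhalf : ((n : ℝ) * N * K + Real.log 2) / (N * Real.log N - N - Real.log (2 * N)) ≤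
      1 / 2 := by
    rw [div_le_iff₀ (mul_log_sub_pos hN)]
    linarith
  linarith [hS.one_sub_lt_failure h hN hd2 hd0 hd]

lemma log_div_le (hS : IsEstimate P π Q X U S') (h : IsExperiment d P π Q X) (hN : 16 ≤ N)
    (hd2 : Even d) (hd0 : 0 < d) (hd : d + 2 ≤ N) (hK : 0 < K)
    (hP : P.real {ω | S' ω ≠ supportUnion d (π ω)} ≤ 1 / 2) :
    1 / 8 * (Real.log N / K) ≤ n := by
  by_contra! hlt
  refine hP.not_gt (hS.half_lt_failure h (by omega) hd2 hd0 hd hK (hlt.le.trans ?_))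
  calc 1 / 8 * (Real.log N / K) = 1 / 4 * Real.log N / 2 / K := by ring
    _ ≤ (Real.log N - 1 - Real.log (8 * N) / N) / 2 / K := by
      gcongr
      exact quarter_log_le hN
    _ = Real.log N / (2 * K) - 1 / (2 * K) - Real.log (8 * N) / (2 * N * K) := by field_simp

end IsEstimate

end Bound

end SupportUnion

theorem theorem3 :
    (∀ N d : ℕ, 5 ≤ N → Even d → 0 < d → d + 2 ≤ N →
      -- the random graph is `d`-regular, and the model is a multivariate sub-Gaussian one
      (∀ π : Equiv.Perm (Fin N),
        (∀ a, {b | (a, b) ∈ SupportUnion.edgeSet d π}.ncard = d) ∧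
        ∀ q ∈ SupportUnion.couplingBox N d,
          SupportUnion.matSupport (SupportUnion.precision d π q) ⊆
            SupportUnion.supportUnion d π ∧
          ∀ σ : ℝ≥0, 1 ≤ σ →
            SupportUnion.IsSubGaussianVector (SupportUnion.gaussianLaw d π q)
              (SupportUnion.precision d π q) σ) ∧
      ∀ (K n : ℕ) (Ω : Type*) [MeasurableSpace Ω] (P : Measure Ω) [IsProbabilityMeasure P]
        (π : Ω → Equiv.Perm (Fin N)) (Q : Ω → Fin K → SupportUnion.Coupling N)
        (X : Ω → SupportUnion.Data N K n), SupportUnion.IsExperiment d P π Q X →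
        -- for i.i.d. `Q^(k)` near a common matrix, conditionally on the permutation the samples
        -- follow a family of random sub-Gaussian distributions with support union `S`
        (∀ q₀ ∈ SupportUnion.couplingBox N d, (∀ a b, a ≠ b → q₀ a b ≠ 0) →
          iIndepFun (fun k ω => Q ω k) P →
          (∀ k l, IdentDistrib (fun ω => Q ω k) (fun ω => Q ω l) P P) →
          ∀ (τ : Equiv.Perm (Fin N)) (c : ℝ), 0 < c →
          (∀ r ∈ spectrum ℝ (SupportUnion.precision d τ q₀), c ≤ r / 2) →
          (∀ᵐ ω ∂P, ∀ k, ‖Matrix.toEuclideanCLM (𝕜 := ℝ)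
            (SupportUnion.edgeMatrix d τ ⊙ Matrix.of (Q ω k - q₀))‖ ≤ c) →
          ∀ σ : ℝ≥0, 1 ≤ σ →
            SupportUnion.IsRandomSubGaussianFamily (ProbabilityTheory.cond P {ω | π ω = τ})
              (SupportUnion.precision d τ q₀)
              (fun ω k a b =>
                (SupportUnion.edgeMatrix d τ ⊙ Matrix.of (Q ω k - q₀)) a b) X σ ∧
            SupportUnion.matSupport (SupportUnion.precision d τ q₀) =
              SupportUnion.supportUnion d τ) ∧
        -- the lower bound on the failure probability, for every estimate
        ∀ (𝓤 : Type*) [MeasurableSpace 𝓤] (U : Ω → 𝓤) (S' : Ω → Set (Fin N × Fin N)),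
          SupportUnion.IsEstimate P π Q X U S' →
          1 - ((n : ℝ) * N * K + Real.log 2) / (N * Real.log N - N - Real.log (2 * N)) ≤
            P.real {ω | S' ω ≠ SupportUnion.supportUnion d (π ω)} ∧
          (0 < K →
            (n : ℝ) ≤ Real.log N / (2 * K) - 1 / (2 * K) - Real.log (8 * N) / (2 * N * K) →
            1 / 2 < P.real {ω | S' ω ≠ SupportUnion.supportUnion d (π ω)})) ∧
    -- `Ω((log N) / K)` samples per task are necessary
    ∃ c : ℝ, 0 < c ∧ ∃ N₀ : ℕ, ∀ N d : ℕ, N₀ ≤ N → 5 ≤ N → Even d → 0 < d → d + 2 ≤ N →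
      ∀ (K n : ℕ), 0 < K → ∀ (Ω : Type*) [MeasurableSpace Ω] (P : Measure Ω)
        [IsProbabilityMeasure P] (π : Ω → Equiv.Perm (Fin N))
        (Q : Ω → Fin K → SupportUnion.Coupling N) (X : Ω → SupportUnion.Data N K n),
        SupportUnion.IsExperiment d P π Q X →
        ∀ (𝓤 : Type*) [MeasurableSpace 𝓤] (U : Ω → 𝓤) (S' : Ω → Set (Fin N × Fin N)),
          SupportUnion.IsEstimate P π Q X U S' →
          P.real {ω | S' ω ≠ SupportUnion.supportUnion d (π ω)} ≤ 1 / 2 →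
          c * (Real.log N / K) ≤ n := by
  refine ⟨fun N d hN hd2 hd0 hd => ⟨fun π => ⟨SupportUnion.ncard_neighbours hd2 (by omega) π,
    fun q hq => ⟨SupportUnion.matSupport_precision_subset π q, fun σ hσ =>
      SupportUnion.isSubGaussianVector_multivariateGaussian
        (SupportUnion.posDef_precision hd2 (by omega) π hq) hσ⟩⟩, ?_⟩,
    1 / 8, by norm_num, 16, ?_⟩
  · intro K n Ω _ P _ π Q X hexp
    refine ⟨fun q₀ hq₀ hne hindep hid τ c hc hspec hnorm σ hσ =>
      ⟨hexp.isRandomSubGaussianFamily hd2 (by omega) hq₀ hne hindep hid τ hc hspec hnorm hσ,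
        SupportUnion.matSupport_precision_eq (by omega) τ hne⟩, ?_⟩
    intro 𝓤 _ U S' hS
    exact ⟨(hS.one_sub_lt_failure hexp hN hd2 hd0 hd).le,
      hS.half_lt_failure hexp hN hd2 hd0 hd⟩
  · intro N d hN _ hd2 hd0 hd K n hK Ω _ P _ π Q X hexp 𝓤 _ U S' hS hP
    exact hS.log_div_le hexp hN hd2 hd0 hd hK hP
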